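/- Let $1/2<H<1$, $0<T<\infty$, $d\ge 1$, and let $B=(B^{(1)},\dots,B^{(d)})$ be a $d$-dimensional fractional Brownian motion with exponent $H$ on a probability space $(\Omega,\mathcal F,\mathbb P)$, i.e. a (measurable) centred Gaussian process on $[0,\infty)$ with $\mathbb E[B^{(i)}_sB^{(j)}_t]=R(s,t)\,\delta_{ij}$, where $R(s,t)=\frac12\{t^{2H}+s^{2H}-|t-s|^{2H}\}$. Write $B_{s,t}=B_t-B_s$, $v(s)=R(s,s)$, $\Theta_{s,t}=v(s)v(t)-R(s,t)^2$ (the determinant of the covariance matrix of $(B^{(1)}_s,B^{(1)}_t)$), $(a\otimes b)_{ij}=a^ib^j$, and let $\frac{\partial R}{\partial s},\frac{\partial R}{\partial t}$ denote differentiation of $R(s,t)=R(t,s)$ in the variables named $s$ and $t$. For $s,t\in(0,T]$ with $s\ne t$ (that is, for almost every $(s,t)\in[0,T]^2$) put $$\lambda_{11}(s,t)=\frac{1}{\Theta_{s,t}}\Big\{\tfrac12 v'(s)v(t)-R(s,t)\tfrac{\partial R}{\partial s}(s,t)\Big\},\qquad \lambda_{12}(s,t)=\frac{1}{\Theta_{s,t}}\Big\{\tfrac{\partial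 R}{\partial s}(s,t)v(s)-R(s,t)\tfrac12v'(s)\Big\},$$ $$\lambda_{21}(s,t)=\frac{1}{\Theta_{s,t}}\Big\{\tfrac{\partial R}{\partial t}(s,t)v(t)-R(s,t)\tfrac12v'(t)\Big\},\qquad \lambda_{22}(s,t)=\frac{1}{\Theta_{s,t}}\Big\{\tfrac12v'(t)v(s)-R(s,t)\tfrac{\partial R}{\partial t}(s,t)\Big\},$$ and define the $d\times d$ matrix field $\mathcal W=(\mathcal W^{ij})$ by $$\mathcal W^{ij}(s,t)=\lambda_{11}\lambda_{21}\big(B^{(i)}_sB^{(j)}_s-\mathrm{cov}(B^{(i)}_s,B^{(j)}_s)\big)+\lambda_{11}\lambda_{22}\big(B^{(i)}_sB^{(j)}_t-\mathrm{cov}(B^{(i)}_s,B^{(j)}_t)\big)$$ $$\qquad+\lambda_{12}\lambda_{21}\big(B^{(i)}_tB^{(j)}_s-\mathrm{cov}(B^{(i)}_t,B^{(j)}_s)\big)+\lambda_{12}\lambda_{22}\big(B^{(i)}_tB^{(j)}_t-\mathrm{cov}(B^{(i)}_t,B^{(j)}_t)\big),$$ where all $\lambda$'s are taken at $(s,t)$.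 For $\epsilon,\delta>0$ let $$\Lambda^-(\epsilon,\delta;s,t)=\frac{1}{\epsilon\delta}\,\mathbb E\big[B_{s,s+\epsilon}\otimes B_{t,t+\delta}\,\big|\,B_s,B_t\big],$$ understood as a field on $\Omega\times[0,T]^2$ through any of its jointly measurable versions (these exist and agree almost everywhere), and let $$\Lambda(s,t)=\mathcal W(s,t)+\frac{\partial^2R}{\partial t\,\partial s}(s,t)\,I_{d\times d}.$$ Then for every $1\le q<\min\{\frac1{2H-1},\frac1{2-2H}\}$ the fields $\Lambda^-(\epsilon,\delta;\cdot)$ and $\Lambda$ belong to $L^q(\Omega\times[0,T]^2;\mathbb R^{d\times d})$ (with respect to $d\mathbb P\times ds\,dt$), and $$\lim_{(\epsilon,\delta)\downarrow0}\Lambda^-(\epsilon,\delta;\cdot)=\Lambda\quad\text{in }L^q(\Omega\times[0,T]^2;\mathbb R^{d\times d}),$$ where $\epsilon\downarrow0$ and $\delta\downarrow0$ simultaneously and independently of each other. -/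

import Mathlib

open MeasureTheory ProbabilityTheory Filter Topology Set
open scoped ENNReal Matrix.Norms.Frobenius

namespace FBM

/-- The covariance function of fractional Brownian motion with Hurst exponent `H`. -/
noncomputable def R (H s t : ℝ) : ℝ :=
  (t ^ (2 * H) + s ^ (2 * H) - |t - s| ^ (2 * H)) / 2

/-- The variance function `v s = R (s, s)`. -/
noncomputable def v (H s : ℝ) : ℝ := R H s s

/-- The partial derivative of `R` with respect to its first argument.  As `R` is symmetric,
`dR H s t` is `∂R/∂s (s, t)` and `dR H t s` is `∂R/∂t (t, s) = ∂R/∂t (s, t)`. -/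
noncomputable def dR (H s t : ℝ) : ℝ := deriv (fun x => R H x t) s

/-- The mixed second derivative `∂²R/∂t∂s (s, t)`. -/
noncomputable def ddR (H s t : ℝ) : ℝ := deriv (fun y => deriv (fun x => R H x y) s) t

/-- The determinant of the covariance matrix of `(B⁽¹⁾_s, B⁽¹⁾_t)`. -/
noncomputable def Theta (H s t : ℝ) : ℝ :=
  Matrix.det !![v H s, R H s t; R H s t, v H t]

noncomputable def lambda11 (H s t : ℝ) : ℝ :=
  1 / Theta H s t * (1 / 2 * deriv (v H) s * v H t - R H s t * dR H s t)

noncomputable def lambda12 (H s t : ℝ) : ℝ :=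
  1 / Theta H s t * (dR H s t * v H s - R H s t * (1 / 2 * deriv (v H) s))

noncomputable def lambda21 (H s t : ℝ) : ℝ :=
  1 / Theta H s t * (dR H t s * v H t - R H s t * (1 / 2 * deriv (v H) t))

noncomputable def lambda22 (H s t : ℝ) : ℝ :=
  1 / Theta H s t * (1 / 2 * deriv (v H) t * v H s - R H s t * dR H t s)

/-- `B` (only its values at times `t ≥ 0` matter) is a `d`-dimensional fractional Brownian motion
with exponent `H` under `μ`: a centred Gaussian process indexed by `[0, ∞)` with covariance
`R H s t` times the identity matrix. -/
structure IsFBM {Ω : Type*} [MeasurableSpace Ω] {d : ℕ} (H : ℝ) (B : ℝ → Ω → (Fin d → ℝ))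
    (μ : Measure Ω) : Prop where
  measurable : ∀ t, 0 ≤ t → Measurable (B t)
  gaussian : IsGaussianProcess (fun t : Set.Ici (0 : ℝ) => B t) μ
  mean_zero : ∀ t, 0 ≤ t → ∀ i, ∫ ω, B t ω i ∂μ = 0
  cov_eq : ∀ s t, 0 ≤ s → 0 ≤ t → ∀ i j,
    cov[fun ω => B s ω i, fun ω => B t ω j; μ] = if i = j then R H s t else 0

/-- The matrix field `𝒲 (s, t)`. -/
noncomputable def W {Ω : Type*} [MeasurableSpace Ω] {d : ℕ} (H : ℝ) (B : ℝ → Ω → (Fin d → ℝ))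
    (μ : Measure Ω) (s t : ℝ) (ω : Ω) : Matrix (Fin d) (Fin d) ℝ :=
  Matrix.of fun i j =>
    lambda11 H s t * lambda21 H s t *
        (B s ω i * B s ω j - cov[fun ω' => B s ω' i, fun ω' => B s ω' j; μ])
      + lambda11 H s t * lambda22 H s t *
        (B s ω i * B t ω j - cov[fun ω' => B s ω' i, fun ω' => B t ω' j; μ])
      + lambda12 H s t * lambda21 H s t *
        (B t ω i * B s ω j - cov[fun ω' => B t ω' i, fun ω' => B s ω' j; μ])
      + lambda12 H s t * lambda22 H s t *
        (B t ω i * B t ω j - cov[fun ω' => B t ω' i, fun ω' => B t ω' j; μ])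

/-- The field `Λ = 𝒲 + (∂²R/∂t∂s) I`, as a function on `Ω × ℝ²`. -/
noncomputable def Lam {Ω : Type*} [MeasurableSpace Ω] {d : ℕ} (H : ℝ)
    (B : ℝ → Ω → (Fin d → ℝ)) (μ : Measure Ω) (x : Ω × (ℝ × ℝ)) : Matrix (Fin d) (Fin d) ℝ :=
  W H B μ x.2.1 x.2.2 x.1 + ddR H x.2.1 x.2.2 • (1 : Matrix (Fin d) (Fin d) ℝ)

/-- The measure `dℙ × ds dt` on `Ω × [0, T]²`. -/
noncomputable def prodMeasure {Ω : Type*} [MeasurableSpace Ω] (μ : Measure Ω) (T : ℝ) :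
    Measure (Ω × (ℝ × ℝ)) :=
  μ.prod ((volume : Measure (ℝ × ℝ)).restrict (Icc 0 T ×ˢ Icc 0 T))

/-- `L` is a jointly measurable version of the normalized conditional covariance field
`(s, t) ↦ (ε δ)⁻¹ 𝔼[B_{s,s+ε} ⊗ B_{t,t+δ} | σ(B_s, B_t)]` on `Ω × [0, T]²`.  (A conditional
expectation is determined only almost surely for each `(s, t)`; any two jointly measurable
versions agree almost everywhere on `Ω × [0, T]²`.) -/
structure IsCondCovField {Ω : Type*} [MeasurableSpace Ω] {d : ℕ} (B : ℝ → Ω → (Fin d → ℝ))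
    (μ : Measure Ω) (T ε δ : ℝ) (L : Ω × (ℝ × ℝ) → Matrix (Fin d) (Fin d) ℝ) : Prop where
  aestronglyMeasurable : AEStronglyMeasurable L (prodMeasure μ T)
  version : ∀ᵐ z : ℝ × ℝ ∂(volume.restrict (Icc 0 T ×ˢ Icc 0 T)), ∀ i j,
    (fun ω => L (ω, z) i j) =ᵐ[μ] fun ω =>
      1 / (ε * δ) *
        (μ[fun ω' => (B (z.1 + ε) ω' i - B z.1 ω' i) * (B (z.2 + δ) ω' j - B z.2 ω' j) |
          MeasurableSpace.comap (fun ω' => (B z.1 ω', B z.2 ω')) inferInstance]) ω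

end FBM

/-! For distinct positive times the pair `(B_s, B_t)` and the two increments are jointly Gaussian,
so each increment is its linear regression on the pair plus a residual that is uncorrelated with the
pair, hence independent of it. The conditional expectation of the product is therefore the product
of the regressions plus the covariance of the residuals, an explicit quadratic polynomial in `(B_s,
B_t)` (`condExp_increments`). After division by `ε δ` its coefficients converge, because the
difference quotients of `R` do, and the λ's are the limiting regression coefficients (`Lam_eq`).
This gives convergence in `L^q(Ω)` for almost every pair of times.

Integrating over the times requires a dominating function free of `ε` and `δ`. By Gaussian scaling
the `L^q(Ω)` norm is controlled by the variances of the two regressions and by the mixed covariance.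
In the basis `(B_s, B_t - B_s)`, for `s < t`, Hölder continuity of the derivative of `|x| ^ (2 * H)`
bounds the covariances of a normalized increment by multiples of `s ^ (2 * H - 1)` and `(t - s) ^ (2
* H - 1)`, while local nondeterminism (`Theta_ge`) bounds the determinant below by a multiple of `s
^ (2 * H) * (t - s) ^ (2 * H)`. Hence the variances are of order `s ^ (2 * H - 2) + (t - s) ^ (2 * H
- 2)` (`regVar_inc_le`), and the mixed covariance is of order `|t - s| ^ (2 * H - 2)`
(`abs_inc₂_le`). These singularities are in `L^q` in time because `(2 - 2 * H) * q < 1`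
(`memLp_singBound`), and dominated convergence concludes. -/

namespace FBM

/-! ### The covariance function and a lower bound for its determinant. -/

section CovarianceFunction

lemma R_comm (H s t : ℝ) : R H s t = R H t s := by
  unfold R; rw [abs_sub_comm]; ring

lemma v_eq {H : ℝ} (hH : 0 < H) (s : ℝ) : v H s = s ^ (2 * H) := by
  simp [v, R, Real.zero_rpow (by positivity : 2 * H ≠ 0)]

lemma v_add_v_sub {H : ℝ} (hH : 0 < H) (s t : ℝ) :
    v H s + v H t - 2 * R H s t = |t - s| ^ (2 * H) := by
  rw [v_eq hH, v_eq hH, R]; ring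

lemma Theta_eq (H s t : ℝ) : Theta H s t = v H s * v H t - R H s t ^ 2 := by
  simp [Theta, Matrix.det_fin_two_of]; ring

lemma Theta_comm (H s t : ℝ) : Theta H s t = Theta H t s := by
  rw [Theta_eq, Theta_eq, R_comm]; ring

lemma R_zero {H : ℝ} (hH : 0 < H) {x : ℝ} (hx : 0 ≤ x) : R H x 0 = 0 := by
  simp [R, abs_of_nonneg hx, Real.zero_rpow (by positivity : 2 * H ≠ 0)]

/-- Bernoulli's inequality, followed by `h / s ≤ (h / s) ^ H`. The factor `H < 1`, where plain
subadditivity has `1`, is the source of the nondegeneracy in `Theta_ge`. -/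
lemma add_rpow_le_add_mul_rpow {H s h : ℝ} (hH : 0 < H) (hH1 : H < 1) (hh : 0 < h) (hs : h ≤ s) :
    (s + h) ^ H ≤ s ^ H + H * h ^ H := by
  have hs0 : 0 < s := hh.trans_le hs
  have h1 : (1 + h / s) ^ H ≤ 1 + H * (h / s) :=
    rpow_one_add_le_one_add_mul_self (by have : 0 ≤ h / s := by positivity
                                         linarith) hH.le hH1.le
  have h2 : h / s ≤ (h / s) ^ H := by
    have := Real.rpow_le_rpow_of_exponent_ge (x := h / s) (by positivity)
      ((div_le_one hs0).2 hs) hH1.le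
    simpa using this
  have h3 : (s + h) ^ H = s ^ H * (1 + h / s) ^ H := by
    rw [← Real.mul_rpow hs0.le (by positivity)]; congr 1; field_simp
  have h4 : h ^ H = s ^ H * (h / s) ^ H := by
    rw [← Real.mul_rpow hs0.le (by positivity)]; congr 1; field_simp
  rw [h3, h4]
  have : 0 < s ^ H := by positivity
  nlinarith [mul_le_mul_of_nonneg_left h2 hH.le]

lemma rpow_two_mul_eq_sq {x : ℝ} (hx : 0 ≤ x) (H : ℝ) : x ^ (2 * H) = (x ^ H) ^ 2 := by
  rw [mul_comm, Real.rpow_mul hx]; norm_num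

/-- Strong local nondeterminism of the covariance of fractional Brownian motion. -/
lemma Theta_ge {H s t : ℝ} (hH : 1 / 2 < H) (hH1 : H < 1) (hs : 0 < s) (hst : s < t) :
    (1 - H) / 2 * (s ^ (2 * H) * (t - s) ^ (2 * H)) ≤ Theta H s t := by
  have hH0 : 0 < H := by linarith
  obtain ⟨h, hh, rfl⟩ : ∃ h, 0 < h ∧ t = s + h := ⟨t - s, by linarith, by ring⟩
  -- Increments are positively correlated since `2 * H > 1`. This makes the quantity squared in
  -- `hA2` nonnegative.
  have hz : (s + h) ^ (2 * H) ≥ s ^ (2 * H) + h ^ (2 * H) :=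
    Real.add_rpow_le_rpow_add hs.le hh.le (by linarith)
  have hmin : (s + h) ^ H ≤ s ^ H + h ^ H - (1 - H) * min (s ^ H) (h ^ H) := by
    rcases le_total h s with hle | hle
    · have := add_rpow_le_add_mul_rpow hH0 hH1 hh hle
      have h' := min_le_right (s ^ H) (h ^ H)
      nlinarith
    · have := add_rpow_le_add_mul_rpow hH0 hH1 hs hle
      have h' := min_le_left (s ^ H) (h ^ H)
      rw [add_comm h s] at this
      nlinarith
  rw [Theta_eq, v_eq hH0, v_eq hH0, R]
  rw [show s + h - s = h by ring, abs_of_pos hh]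
  rw [rpow_two_mul_eq_sq hs.le, rpow_two_mul_eq_sq hh.le,
    rpow_two_mul_eq_sq (by positivity)] at *
  have hx : 0 < s ^ H := by positivity
  have hy : 0 < h ^ H := by positivity
  have hz0 : 0 < (s + h) ^ H := by positivity
  generalize s ^ H = x at *
  generalize h ^ H = y at *
  generalize (s + h) ^ H = z at *
  -- With `m = min x y`, `hmin` gives `(x + y) ^ 2 - z ^ 2 ≥ (1 - H) * m * (x + y + z)`, and `m * (x
  -- + y) ≥ x * y`.
  have hA : z ^ 2 - x ^ 2 - y ^ 2 ≤ (1 + H) * (x * y) := by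
    have hm : 0 < min x y := lt_min hx hy
    have hmm : x * y ≤ min x y * (x + y) := by
      rcases le_total x y with h | h
      · rw [min_eq_left h]; nlinarith
      · rw [min_eq_right h]; nlinarith
    nlinarith [mul_le_mul_of_nonneg_left hmm (by linarith : 0 ≤ 1 - H),
      mul_le_mul_of_nonneg_right hmin (by positivity : 0 ≤ x + y + z),
      mul_pos (by linarith : 0 < 1 - H) (mul_pos hm hz0)]
  have hA2 : (z ^ 2 - x ^ 2 - y ^ 2) ^ 2 ≤ ((1 + H) * (x * y)) ^ 2 :=
    pow_le_pow_left₀ (by linarith) hA 2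
  have hxy : 0 < (x * y) ^ 2 := by positivity
  -- As in Heron's formula, `4 Θ = 4 x² y² - (z² - x² - y²)²`. So `Θ ≥ (1 - H)(3 + H) / 4 * x² y²`,
  -- and `(3 + H) / 4 ≥ 1 / 2`.
  nlinarith [mul_nonneg hxy.le (by nlinarith : 0 ≤ (1 - H) * (1 + H))]

lemma Theta_pos {H s t : ℝ} (hH : 1 / 2 < H) (hH1 : H < 1) (hs : 0 < s) (ht : 0 < t)
    (hst : s ≠ t) : 0 < Theta H s t := by
  have key : ∀ s t : ℝ, 0 < s → s < t → 0 < Theta H s t := fun s t hs hst =>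
    lt_of_lt_of_le (by have : 0 < t - s := by linarith
                       have : 0 < 1 - H := by linarith
                       positivity) (Theta_ge hH hH1 hs hst)
  rcases lt_or_gt_of_ne hst with h | h
  · exact key s t hs h
  · rw [Theta_comm]; exact key t s ht h

end CovarianceFunction

/-! ### The derivative of the power `|x| ^ (2 * H)` and its Hölder continuity. -/

section SignedPower

/-- The signed power `|x| ^ (2 H - 1) sgn x`. -/
noncomputable def spow (H x : ℝ) : ℝ := |x| ^ (2 * H - 2) * x

lemma spow_of_nonneg {H x : ℝ} (hH : 1 / 2 < H) (hx : 0 ≤ x) : spow H x = x ^ (2 * H - 1) := by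
  rcases hx.eq_or_lt with rfl | hx
  · simp [spow, Real.zero_rpow (by linarith : 2 * H - 1 ≠ 0)]
  · rw [spow, abs_of_pos hx, ← Real.rpow_add_one hx.ne']; congr 1; ring

lemma spow_neg (H x : ℝ) : spow H (-x) = -spow H x := by simp [spow]

lemma rpow_sub_rpow_le {p x y : ℝ} (hp : 0 ≤ p) (hp1 : p ≤ 1) (hy : 0 ≤ y) (hyx : y ≤ x) :
    x ^ p - y ^ p ≤ (x - y) ^ p := by
  have := Real.rpow_add_le_add_rpow (a := x - y) (b := y) (by linarith) hy hp hp1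
  simp only [sub_add_cancel] at this
  linarith

/-- For arguments of equal sign this is subadditivity of the power `2 * H - 1 ≤ 1`. For opposite
signs each of the two terms is at most `|x - y| ^ (2 * H - 1)`, whence the factor `2`. -/
lemma abs_spow_sub_le {H : ℝ} (hH : 1 / 2 < H) (hH1 : H < 1) (x y : ℝ) :
    |spow H x - spow H y| ≤ 2 * |x - y| ^ (2 * H - 1) := by
  have hp : 0 ≤ 2 * H - 1 := by linarith
  have hp1 : 2 * H - 1 ≤ 1 := by linarith
  have pos : ∀ x y : ℝ, 0 ≤ y → y ≤ x → |spow H x - spow H y| ≤ 2 * |x - y| ^ (2 * H - 1) := by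
    intro x y hy hyx
    have h0 : (0 : ℝ) ≤ (x - y) ^ (2 * H - 1) := Real.rpow_nonneg (by linarith) _
    rw [spow_of_nonneg hH hy, spow_of_nonneg hH (hy.trans hyx),
      abs_of_nonneg (sub_nonneg.2 (Real.rpow_le_rpow hy hyx hp)), abs_of_nonneg (sub_nonneg.2 hyx)]
    linarith [rpow_sub_rpow_le hp hp1 hy hyx]
  have key : ∀ x y : ℝ, y ≤ x → |spow H x - spow H y| ≤ 2 * |x - y| ^ (2 * H - 1) := by
    intro x y hyx
    rcases le_total 0 y with hy | hy
    · exact pos x y hy hyx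
    · rcases le_total 0 x with hx | hx
      · have e : spow H y = -((-y) ^ (2 * H - 1)) := by
          rw [← spow_of_nonneg hH (by linarith), spow_neg, neg_neg]
        rw [e, spow_of_nonneg hH hx, sub_neg_eq_add, abs_of_nonneg (by linarith : 0 ≤ x - y),
          abs_of_nonneg (add_nonneg (Real.rpow_nonneg hx _) (Real.rpow_nonneg (by linarith) _))]
        have h1 := Real.rpow_le_rpow hx (by linarith : x ≤ x - y) hp
        have h2 := Real.rpow_le_rpow (by linarith) (by linarith : -y ≤ x - y) hp
        linarith
      · have := pos (-y) (-x) (by linarith) (by linarith)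
        rw [spow_neg, spow_neg] at this
        rwa [show -spow H y - -spow H x = spow H x - spow H y by ring,
          show -y - -x = x - y by ring] at this
  rcases le_total y x with h | h
  · exact key x y h
  · rw [abs_sub_comm, abs_sub_comm x]; exact key y x h

lemma hasDerivAt_abs_rpow_two_mul {H : ℝ} (hH : 1 / 2 < H) (x : ℝ) :
    HasDerivAt (fun x : ℝ => |x| ^ (2 * H)) (2 * H * spow H x) x := by
  have := hasDerivAt_abs_rpow x (p := 2 * H) (by linarith)
  rwa [mul_assoc] at this

lemma hasDerivAt_spow {H x : ℝ} (hx : x ≠ 0) :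
    HasDerivAt (spow H) ((2 * H - 1) * |x| ^ (2 * H - 2)) x := by
  have h := ((hasDerivAt_abs hx).rpow_const (p := 2 * H - 2) (.inl (abs_ne_zero.2 hx))).mul
    (hasDerivAt_id x)
  refine h.congr_deriv ?_
  have e : |x| ^ (2 * H - 2) = |x| ^ (2 * H - 2 - 1) * |x| := by
    rw [← Real.rpow_add_one (abs_ne_zero.2 hx)]; congr 1; ring
  have e2 : (SignType.sign x : ℝ) * x = |x| := sign_mul_self x
  simp only [id]
  rw [e, ← e2]
  ring

end SignedPower

/-! ### Derivatives of the covariance function. -/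

section Derivatives

lemma hasDerivAt_R_left {H : ℝ} (hH : 1 / 2 < H) (s t : ℝ) :
    HasDerivAt (fun x => R H x t) (H * s ^ (2 * H - 1) + H * spow H (t - s)) s := by
  have h1 : HasDerivAt (fun x : ℝ => x ^ (2 * H)) (2 * H * s ^ (2 * H - 1)) s :=
    Real.hasDerivAt_rpow_const (.inr (by linarith))
  have h2 : HasDerivAt (fun x : ℝ => |t - x| ^ (2 * H)) (2 * H * spow H (t - s) * (-1)) s :=
    HasDerivAt.comp s (h₂ := fun x : ℝ => |x| ^ (2 * H)) (hasDerivAt_abs_rpow_two_mul hH (t - s))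
      ((hasDerivAt_id s).const_sub t)
  refine (((h1.const_add (t ^ (2 * H))).sub h2).div_const 2).congr_deriv ?_
  ring

lemma dR_eq {H : ℝ} (hH : 1 / 2 < H) (s t : ℝ) :
    dR H s t = H * s ^ (2 * H - 1) + H * spow H (t - s) := (hasDerivAt_R_left hH s t).deriv

lemma deriv_v {H : ℝ} (hH : 1 / 2 < H) (s : ℝ) : 1 / 2 * deriv (v H) s = dR H s s := by
  have : v H = fun x => x ^ (2 * H) := funext (v_eq (by linarith))
  rw [this, (Real.hasDerivAt_rpow_const (.inr (by linarith))).deriv, dR_eq hH]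
  simp [spow]
  ring

lemma ddR_eq {H : ℝ} (hH : 1 / 2 < H) {s t : ℝ} (hst : s ≠ t) :
    ddR H s t = H * (2 * H - 1) * |t - s| ^ (2 * H - 2) := by
  have e : (fun y => deriv (fun x => R H x y) s)
      = fun y => H * s ^ (2 * H - 1) + H * spow H (y - s) :=
    funext fun y => (hasDerivAt_R_left hH s y).deriv
  rw [ddR, e]
  have h : HasDerivAt (fun y => spow H (y - s)) ((2 * H - 1) * |t - s| ^ (2 * H - 2) * 1) t :=
    HasDerivAt.comp t (h₂ := spow H) (hasDerivAt_spow (sub_ne_zero.2 hst.symm))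
      ((hasDerivAt_id t).sub_const s)
  rw [((h.const_mul H).const_add _).deriv]
  ring

end Derivatives

/-! ### Covariances of increments: mean value formulas and uniform bounds. -/

section Increments

/-- The covariance of the increment `B_{x,x+ε}` with `B_y`. -/
noncomputable def inc (H x ε y : ℝ) : ℝ := R H (x + ε) y - R H x y

/-- The covariance of the increments `B_{s,s+ε}` and `B_{t,t+δ}`. -/
noncomputable def inc₂ (H s ε t δ : ℝ) : ℝ := inc H t δ (s + ε) - inc H t δ s

lemma inc₂_comm (H s ε t δ : ℝ) : inc₂ H s ε t δ = inc₂ H t δ s ε := by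
  unfold inc₂ inc
  rw [R_comm H (t + δ), R_comm H (t + δ), R_comm H t, R_comm H t]
  ring

lemma inc_zero {H x ε : ℝ} (hH : 0 < H) (hx : 0 ≤ x) (hε : 0 ≤ ε) : inc H x ε 0 = 0 := by
  simp [inc, R_zero hH hx, R_zero hH (add_nonneg hx hε)]

/-- Mean value theorem for `R(·, b) - R(·, a)`. The term `H * u ^ (2 * H - 1)` cancels in the
difference, so only the translation-invariant part of the derivative remains. -/
lemma exists_inc_sub_inc_eq {H : ℝ} (hH : 1 / 2 < H) (x a b : ℝ) {ε : ℝ} (hε : 0 < ε) :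
    ∃ u ∈ Ioo x (x + ε),
      inc H x ε b - inc H x ε a = ε * (H * (spow H (b - u) - spow H (a - u))) := by
  have hd : ∀ u, HasDerivAt (fun u => R H u b - R H u a)
      (H * (spow H (b - u) - spow H (a - u))) u := fun u =>
    ((hasDerivAt_R_left hH u b).sub (hasDerivAt_R_left hH u a)).congr_deriv (by ring)
  obtain ⟨u, hu, hu'⟩ := exists_hasDerivAt_eq_slope (fun u => R H u b - R H u a) _
    (by linarith : x < x + ε) (fun u _ => (hd u).continuousAt.continuousWithinAt)
    (fun u _ => hd u)
  refine ⟨u, hu, ?_⟩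
  rw [hu', inc, inc, add_sub_cancel_left, mul_div_cancel₀ _ hε.ne']
  ring

lemma abs_inc_sub_inc_le {H : ℝ} (hH : 1 / 2 < H) (hH1 : H < 1) (x a b : ℝ) {ε : ℝ} (hε : 0 < ε) :
    |inc H x ε b - inc H x ε a| ≤ 2 * ε * |b - a| ^ (2 * H - 1) := by
  obtain ⟨u, -, h⟩ := exists_inc_sub_inc_eq hH x a b hε
  have h1 := abs_spow_sub_le hH hH1 (b - u) (a - u)
  rw [show b - u - (a - u) = b - a by ring] at h1
  rw [h, abs_mul, abs_mul, abs_of_pos hε, abs_of_pos (by linarith : 0 < H)]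
  have h2 : 0 ≤ |b - a| ^ (2 * H - 1) := by positivity
  have h3 := abs_nonneg (spow H (b - u) - spow H (a - u))
  nlinarith [mul_le_mul_of_nonneg_left h1 hε.le, mul_nonneg hε.le h3]

lemma abs_inc_le {H : ℝ} (hH : 1 / 2 < H) (hH1 : H < 1) {x b ε : ℝ} (hx : 0 ≤ x) (hb : 0 ≤ b)
    (hε : 0 < ε) : |inc H x ε b| ≤ 2 * ε * b ^ (2 * H - 1) := by
  have := abs_inc_sub_inc_le hH hH1 x 0 b hε
  rwa [inc_zero (by linarith) hx hε.le, sub_zero, sub_zero, abs_of_nonneg hb] at this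

/-- A second mean value theorem, in the other time. The separation hypothesis keeps `y - u` away
from `0`, where `spow` is not differentiable. -/
lemma exists_inc₂_eq {H : ℝ} (hH : 1 / 2 < H) {s t ε δ : ℝ} (hε : 0 < ε) (hδ : 0 < δ)
    (hst : ε + δ < |t - s|) :
    ∃ w, |w - (t - s)| ≤ max ε δ ∧
      inc₂ H s ε t δ = ε * δ * (H * (2 * H - 1) * |w| ^ (2 * H - 2)) := by
  obtain ⟨u, hu, h⟩ := exists_inc_sub_inc_eq hH s t (t + δ) hε
  have hne : ∀ y ∈ Icc t (t + δ), y - u ≠ 0 := by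
    rintro y ⟨hy1, hy2⟩ h0
    have : |t - s| ≤ ε + δ := abs_le.2 ⟨by linarith [hu.1, hu.2], by linarith [hu.1, hu.2]⟩
    linarith
  have hd : ∀ y ∈ Icc t (t + δ), HasDerivAt (fun y => spow H (y - u))
      ((2 * H - 1) * |y - u| ^ (2 * H - 2)) y := fun y hy =>
    (HasDerivAt.comp y (h₂ := spow H) (hasDerivAt_spow (hne y hy))
      ((hasDerivAt_id y).sub_const u)).congr_deriv (by simp)
  obtain ⟨y, hy, hy'⟩ := exists_hasDerivAt_eq_slope (fun y => spow H (y - u)) _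
    (by linarith : t < t + δ) (fun y hy => (hd y hy).continuousAt.continuousWithinAt)
    (fun y hy => hd y (Ioo_subset_Icc_self hy))
  refine ⟨y - u, ?_, ?_⟩
  · have h1 := le_max_left ε δ
    have h2 := le_max_right ε δ
    exact abs_le.2 ⟨by linarith [hu.1, hu.2, hy.1, hy.2], by linarith [hu.1, hu.2, hy.1, hy.2]⟩
  · rw [inc₂_comm, inc₂, h, mul_assoc H, hy', add_sub_cancel_left]
    field_simp

lemma half_rpow_le {H x y : ℝ} (hH : 1 / 2 < H) (hH1 : H < 1) (hx : 0 < x) (hxy : x / 2 ≤ y) :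
    y ^ (2 * H - 2) ≤ 2 * x ^ (2 * H - 2) := by
  have h1 : y ^ (2 * H - 2) ≤ (x / 2) ^ (2 * H - 2) :=
    Real.rpow_le_rpow_of_nonpos (by positivity) hxy (by linarith)
  have h2 : (x / 2) ^ (2 * H - 2) = x ^ (2 * H - 2) * 2 ^ (2 - 2 * H) := by
    rw [Real.div_rpow hx.le (by norm_num), div_eq_mul_inv, ← Real.rpow_neg (by norm_num)]
    congr 2; ring
  have h3 : (2 : ℝ) ^ (2 - 2 * H) ≤ 2 ^ (1 : ℝ) :=
    Real.rpow_le_rpow_of_exponent_le (by norm_num) (by linarith)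
  rw [Real.rpow_one] at h3
  have : 0 < x ^ (2 * H - 2) := by positivity
  nlinarith

/-- If both increments are shorter than `|t - s| / 2`, the mean value point `w` has `|w| ≥ |t - s| /
2`. Otherwise one of them, say `ε`, is longer, and the Hölder bound `2 * δ * ε ^ (2 * H - 1)` equals
`2 * ε * δ * ε ^ (2 * H - 2)`. Halving the base of the negative power costs at most a factor `2`. -/
lemma abs_inc₂_le {H : ℝ} (hH : 1 / 2 < H) (hH1 : H < 1) {s t ε δ : ℝ} (hst : s ≠ t)
    (hε : 0 < ε) (hδ : 0 < δ) :
    |inc₂ H s ε t δ| ≤ ε * δ * (4 * |t - s| ^ (2 * H - 2)) := by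
  have hd : 0 < |t - s| := abs_pos.2 (sub_ne_zero.2 hst.symm)
  have big : ∀ s t ε δ : ℝ, 0 < |t - s| → 0 < ε → 0 < δ → |t - s| / 2 ≤ ε →
      |inc₂ H s ε t δ| ≤ ε * δ * (4 * |t - s| ^ (2 * H - 2)) := by
    intro s t ε δ hd hε hδ hle
    have h1 := abs_inc_sub_inc_le hH hH1 t s (s + ε) hδ
    rw [show s + ε - s = ε by ring, abs_of_pos hε] at h1
    have h2 : ε ^ (2 * H - 1) = ε ^ (2 * H - 2) * ε := by
      rw [← Real.rpow_add_one hε.ne']; congr 1; ring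
    rw [h2] at h1
    have h3 := half_rpow_le hH hH1 hd hle
    refine h1.trans ?_
    nlinarith [mul_le_mul_of_nonneg_left h3 (mul_pos hε hδ).le]
  rcases le_or_gt (|t - s| / 2) ε with h | h
  · exact big s t ε δ hd hε hδ h
  rcases le_or_gt (|t - s| / 2) δ with h' | h'
  · rw [inc₂_comm, abs_sub_comm, mul_comm ε]
    rw [abs_sub_comm] at hd h'
    exact big t s δ ε hd hδ hε h'
  obtain ⟨w, hw, e⟩ := exists_inc₂_eq hH (s := s) (t := t) hε hδ (by linarith)
  have hw2 : |t - s| / 2 ≤ |w| := by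
    have h1 := max_le h.le h'.le
    have h2 := abs_sub_abs_le_abs_sub (t - s) w
    rw [abs_sub_comm _ w] at h2
    linarith
  have h3 := half_rpow_le hH hH1 hd hw2
  have h4 : 0 < |w| ^ (2 * H - 2) := Real.rpow_pos_of_pos (by linarith) _
  rw [e, abs_of_nonneg (mul_nonneg (mul_pos hε hδ).le
    (mul_nonneg (mul_nonneg (by linarith) (by linarith)) h4.le))]
  refine mul_le_mul_of_nonneg_left ?_ (mul_pos hε hδ).le
  have h5 : H * (2 * H - 1) ≤ 1 := by nlinarith
  nlinarith

end Increments

/-! ### Limits of the normalized covariances. -/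

section Limits

lemma tendsto_inc_div {H : ℝ} (hH : 1 / 2 < H) (x y : ℝ) :
    Tendsto (fun ε => inc H x ε y / ε) (𝓝[>] 0) (𝓝 (dR H x y)) := by
  have h := (hasDerivAt_R_left hH x y).tendsto_slope_zero_right
  rw [← dR_eq hH] at h
  refine h.congr fun ε => ?_
  rw [smul_eq_mul, inc, div_eq_inv_mul]

lemma tendsto_inc₂_div {H : ℝ} (hH : 1 / 2 < H) {s t : ℝ} (hst : s ≠ t) :
    Tendsto (fun p : ℝ × ℝ => inc₂ H s p.1 t p.2 / (p.1 * p.2)) (𝓝[>] 0 ×ˢ 𝓝[>] 0)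
      (𝓝 (ddR H s t)) := by
  rw [ddR_eq hH hst]
  have hne : t - s ≠ 0 := sub_ne_zero.2 hst.symm
  have hd : 0 < |t - s| := abs_pos.2 hne
  have hc : Tendsto (fun w : ℝ => H * (2 * H - 1) * |w| ^ (2 * H - 2)) (𝓝 (t - s))
      (𝓝 (H * (2 * H - 1) * |t - s| ^ (2 * H - 2))) := by
    refine Tendsto.const_mul _ ?_
    exact (continuous_abs.continuousAt).rpow_const (.inl hd.ne')
  rw [Metric.tendsto_nhds] at hc ⊢
  intro η hη
  obtain ⟨r, hr, hball⟩ := Metric.eventually_nhds_iff.1 (hc η hη)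
  have hev : ∀ c : ℝ, 0 < c → ∀ᶠ ε in 𝓝[>] (0 : ℝ), ε ∈ Ioo 0 c := fun c hc =>
    Ioo_mem_nhdsGT hc
  have hm : 0 < min r (|t - s| / 2) := lt_min hr (by positivity)
  filter_upwards [(hev _ hm).prod_mk (hev _ hm)] with p hp
  obtain ⟨⟨h1, h2⟩, h3, h4⟩ := hp
  rw [lt_min_iff] at h2 h4
  obtain ⟨w, hw, e⟩ := exists_inc₂_eq hH (s := s) (t := t) h1 h3 (by linarith)
  rw [e, mul_div_cancel_left₀ _ (mul_pos h1 h3).ne']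
  apply hball
  rw [Real.dist_eq]
  exact hw.trans_lt (max_lt h2.1 h4.1)

end Limits

/-! ### Linear regression on the pair of values, and the bound on its variance. -/

section Regression

/-- The coefficient of `B_s` in the regression on `(B_s, B_t)` of a variable whose covariances with
`B_s` and `B_t` are `p` and `r`. -/
noncomputable def regL (H s t p r : ℝ) : ℝ := (p * v H t - R H s t * r) / Theta H s t

/-- The coefficient of `B_t` in the same regression. -/
noncomputable def regR (H s t p r : ℝ) : ℝ := (r * v H s - R H s t * p) / Theta H s t

/-- The covariance of `a B_s + b B_t` and `a' B_s + b' B_t`. -/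
noncomputable def bil (H s t a b a' b' : ℝ) : ℝ :=
  a * a' * v H s + (a * b' + b * a') * R H s t + b * b' * v H t

/-- With `bil_regR`, the normal equations: the residual of the regression is uncorrelated with `B_s`
and `B_t`. -/
lemma bil_regL {H s t p r : ℝ} (hΘ : Theta H s t ≠ 0) :
    regL H s t p r * v H s + regR H s t p r * R H s t = p := by
  unfold regL regR
  field_simp
  rw [Theta_eq]; ring

lemma bil_regR {H s t p r : ℝ} (hΘ : Theta H s t ≠ 0) :
    regL H s t p r * R H s t + regR H s t p r * v H t = r := by
  unfold regL regR
  field_simp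
  rw [Theta_eq]; ring

/-- Cauchy–Schwarz for the covariance form; the defect is the determinant times the square of `a *
b' - b * a'`. -/
lemma bil_sq_le {H s t : ℝ} (hΘ : 0 ≤ Theta H s t) (a b a' b' : ℝ) :
    bil H s t a b a' b' ^ 2 ≤ bil H s t a b a b * bil H s t a' b' a' b' := by
  have : bil H s t a b a b * bil H s t a' b' a' b' - bil H s t a b a' b' ^ 2
      = Theta H s t * (a * b' - b * a') ^ 2 := by
    rw [Theta_eq]; unfold bil; ring
  nlinarith [mul_nonneg hΘ (sq_nonneg (a * b' - b * a'))]

/-- The variance of the regression of a variable with covariances `p`, `r` on `(B_s, B_t)`. -/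
noncomputable def regVar (H s t p r : ℝ) : ℝ :=
  bil H s t (regL H s t p r) (regR H s t p r) (regL H s t p r) (regR H s t p r)

lemma regVar_eq {H s t p r : ℝ} (hΘ : Theta H s t ≠ 0) :
    regVar H s t p r = (p ^ 2 * v H t - 2 * R H s t * p * r + r ^ 2 * v H s) / Theta H s t := by
  have h1 := bil_regL (p := p) (r := r) hΘ
  have h2 := bil_regR (p := p) (r := r) hΘ
  have : regVar H s t p r = regL H s t p r * p + regR H s t p r * r := by
    unfold regVar bil
    generalize regL H s t p r = a at *
    generalize regR H s t p r = b at *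
    rw [← h1, ← h2]; ring
  rw [this]; unfold regL regR
  field_simp
  ring

lemma regVar_comm {H s t p r : ℝ} (hΘ : Theta H s t ≠ 0) :
    regVar H s t p r = regVar H t s r p := by
  rw [regVar_eq hΘ, regVar_eq (by rwa [Theta_comm]), Theta_comm, R_comm]
  ring

/-- In the basis `(B_s, B_t - B_s)` the variables have variances `x = s ^ (2 * H)` and `y = (t - s)
^ (2 * H)`, and the covariances to be regressed are `p` and `r - p`. Absorbing the cross term bounds
the numerator by `2 * (p² y + (r - p)² x)`, and `Theta_ge` divides this by a multiple of `x y`. -/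
lemma regVar_le_of_lt {H : ℝ} (hH : 1 / 2 < H) (hH1 : H < 1) {s t p r K : ℝ} (hs : 0 < s)
    (hst : s < t) (hp : |p| ≤ K * s ^ (2 * H - 1)) (hr : |r - p| ≤ K * (t - s) ^ (2 * H - 1)) :
    regVar H s t p r ≤
      4 / (1 - H) * K ^ 2 * (s ^ (2 * H - 2) + (t - s) ^ (2 * H - 2)) := by
  have hΘ := Theta_pos hH hH1 hs (hs.trans hst) hst.ne
  have hh : 0 < t - s := by linarith
  have hge := Theta_ge hH hH1 hs hst
  have hv := v_add_v_sub (by linarith : 0 < H) s t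
  rw [abs_of_pos hh] at hv
  have hvs := v_eq (by linarith : 0 < H) s
  have e : ∀ x : ℝ, 0 < x → (x ^ (2 * H - 1)) ^ 2 = x ^ (2 * H) * x ^ (2 * H - 2) := by
    intro x hx
    rw [← Real.rpow_natCast, ← Real.rpow_mul hx.le, ← Real.rpow_add hx]
    congr 1; push_cast; ring
  have hp2 : p ^ 2 ≤ K ^ 2 * (s ^ (2 * H) * s ^ (2 * H - 2)) := by
    rw [← e s hs, ← mul_pow, ← sq_abs p]
    exact pow_le_pow_left₀ (abs_nonneg _) hp 2
  have hr2 : (r - p) ^ 2 ≤ K ^ 2 * ((t - s) ^ (2 * H) * (t - s) ^ (2 * H - 2)) := by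
    rw [← e _ hh, ← mul_pow, ← sq_abs (r - p)]
    exact pow_le_pow_left₀ (abs_nonneg _) hr 2
  have hΘ' := Theta_eq H s t
  rw [regVar_eq hΘ.ne', div_le_iff₀ hΘ]
  have hx : 0 < s ^ (2 * H) := by positivity
  have hy : 0 < (t - s) ^ (2 * H) := by positivity
  have hx2 : 0 < s ^ (2 * H - 2) := by positivity
  have hy2 : 0 < (t - s) ^ (2 * H - 2) := by positivity
  generalize s ^ (2 * H) = x at *
  generalize (t - s) ^ (2 * H) = y at *
  generalize s ^ (2 * H - 2) = x' at *
  generalize (t - s) ^ (2 * H - 2) = y' at *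
  generalize v H t = vt at *
  rw [hvs] at *
  generalize R H s t = ρ at *
  generalize Theta H s t = θ at *
  obtain rfl : vt = y - x + 2 * ρ := by linarith
  -- This is `0 ≤ θ`, since `θ = x y - (x - ρ)²` in the new basis.
  have hw : (x - ρ) ^ 2 ≤ x * y := by nlinarith
  have h1 : 0 ≤ p ^ 2 * y - 2 * p * (r - p) * (x - ρ) + (r - p) ^ 2 * x := by
    refine nonneg_of_mul_nonneg_right (a := x) ?_ hx
    nlinarith [mul_nonneg (sq_nonneg p) (sub_nonneg.2 hw),
      sq_nonneg (p * (x - ρ) - (r - p) * x)]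
  have h2 : p ^ 2 * (y - x + 2 * ρ) - 2 * ρ * p * r + r ^ 2 * x
      ≤ 2 * (p ^ 2 * y + (r - p) ^ 2 * x) := by nlinarith
  have h3 : 2 * (p ^ 2 * y + (r - p) ^ 2 * x) ≤ 2 * K ^ 2 * (x' + y') * (x * y) := by
    nlinarith [mul_le_mul_of_nonneg_right hp2 hy.le, mul_le_mul_of_nonneg_right hr2 hx.le]
  refine (h2.trans h3).trans ?_
  have h4 : 0 ≤ 4 / (1 - H) * K ^ 2 * (x' + y') := by
    have : 0 < 1 - H := by linarith
    positivity
  refine le_trans (le_of_eq ?_) (mul_le_mul_of_nonneg_left hge h4)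
  have : 1 - H ≠ 0 := by linarith
  field_simp
  ring

/-- The time singularity which dominates the conditional covariances. -/
noncomputable def singBound (H : ℝ) (z : ℝ × ℝ) : ℝ :=
  |z.1| ^ (2 * H - 2) + |z.2| ^ (2 * H - 2) + |z.2 - z.1| ^ (2 * H - 2)

lemma singBound_nonneg (H : ℝ) (z : ℝ × ℝ) : 0 ≤ singBound H z := by
  unfold singBound; positivity

/-- The Hölder bounds feed `regVar_le_of_lt` with `K = 2`, uniformly in `ε` and in the base time
`x`. Symmetry covers `t < s`, which is why `singBound` contains powers of both times. -/
lemma regVar_inc_le {H : ℝ} (hH : 1 / 2 < H) (hH1 : H < 1) {s t x ε : ℝ} (hs : 0 < s)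
    (ht : 0 < t) (hst : s ≠ t) (hx : 0 ≤ x) (hε : 0 < ε) :
    regVar H s t (inc H x ε s / ε) (inc H x ε t / ε) ≤ 16 / (1 - H) * singBound H (s, t) := by
  have key : ∀ s t : ℝ, 0 < s → s < t →
      regVar H s t (inc H x ε s / ε) (inc H x ε t / ε) ≤
        16 / (1 - H) * (s ^ (2 * H - 2) + (t - s) ^ (2 * H - 2)) := by
    intro s t hs hst
    refine (regVar_le_of_lt hH hH1 (K := 2) hs hst ?_ ?_).trans (le_of_eq (by ring))
    · rw [abs_div, abs_of_pos hε, div_le_iff₀ hε]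
      linarith [abs_inc_le hH hH1 hx hs.le hε]
    · rw [← sub_div, abs_div, abs_of_pos hε, div_le_iff₀ hε]
      have := abs_inc_sub_inc_le hH hH1 x s t hε
      rw [abs_of_pos (by linarith : 0 < t - s)] at this
      linarith
  have hc : 0 < 16 / (1 - H) := by
    have : 0 < 1 - H := by linarith
    positivity
  unfold singBound
  simp only [abs_of_pos hs, abs_of_pos ht]
  have hs' : 0 < s ^ (2 * H - 2) := by positivity
  have ht' : 0 < t ^ (2 * H - 2) := by positivity
  rcases lt_or_gt_of_ne hst with h | h
  · refine (key s t hs h).trans ?_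
    rw [abs_of_pos (by linarith : 0 < t - s)]
    gcongr
    linarith
  · rw [regVar_comm (Theta_pos hH hH1 hs ht hst).ne']
    refine (key t s ht h).trans ?_
    rw [abs_sub_comm, abs_of_pos (by linarith : 0 < s - t)]
    gcongr
    linarith

end Regression

/-! ### Conditional expectation of a product with independent residuals. -/

section ConditionalExpectation

variable {Ω : Type*} {mΩ : MeasurableSpace Ω} {μ : Measure Ω} [IsProbabilityMeasure μ]

/-- If `U`, `V` are functions of `P` and `(Z, Y)` is centred and independent of `P`, then
`𝔼[(U + Z) (V + Y) | P] = U V + 𝔼[Z Y]`. -/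
lemma condExp_add_mul_add_of_indepFun {E : Type*} [MeasurableSpace E] {P : Ω → E}
    (hP : Measurable P) {U V Z Y : Ω → ℝ}
    (hU : Measurable[MeasurableSpace.comap P inferInstance] U)
    (hV : Measurable[MeasurableSpace.comap P inferInstance] V)
    (hZm : Measurable Z) (hYm : Measurable Y)
    (hU2 : MemLp U 2 μ) (hV2 : MemLp V 2 μ) (hZ2 : MemLp Z 2 μ) (hY2 : MemLp Y 2 μ)
    (hind : IndepFun P (fun ω => (Z ω, Y ω)) μ) (hZ : ∫ ω, Z ω ∂μ = 0) (hY : ∫ ω, Y ω ∂μ = 0) :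
    μ[fun ω => (U ω + Z ω) * (V ω + Y ω) | MeasurableSpace.comap P inferInstance]
      =ᵐ[μ] fun ω => U ω * V ω + ∫ ω', Z ω' * Y ω' ∂μ := by
  set m : MeasurableSpace Ω := MeasurableSpace.comap P inferInstance with hm
  have hle : m ≤ mΩ := hP.comap_le
  have indep : ∀ f : ℝ × ℝ → ℝ, Measurable f →
      μ[fun ω => f (Z ω, Y ω) | m] =ᵐ[μ] fun _ => ∫ ω, f (Z ω, Y ω) ∂μ := by
    intro f hf
    have hZY : @Measurable _ _ mΩ _ fun ω => (Z ω, Y ω) := hZm.prodMk hYm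
    refine condExp_indep_eq (m₁ := MeasurableSpace.comap (fun ω => (Z ω, Y ω)) inferInstance)
      hZY.comap_le hle ?_ ?_
    · exact (hf.comp (comap_measurable _)).stronglyMeasurable
    · exact (IndepFun_iff_Indep _ _ _).1 hind.symm
  have iUV : Integrable (U * V) μ := hU2.integrable_mul hV2
  have iUY : Integrable (U * Y) μ := hU2.integrable_mul hY2
  have iVZ : Integrable (V * Z) μ := hV2.integrable_mul hZ2
  have iZY : Integrable (Z * Y) μ := hZ2.integrable_mul hY2
  have e : (fun ω => (U ω + Z ω) * (V ω + Y ω)) = (U * V + U * Y) + (V * Z + Z * Y) := by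
    ext ω; simp; ring
  have h1 : μ[U * V | m] = U * V :=
    condExp_of_stronglyMeasurable hle (hU.mul hV).stronglyMeasurable iUV
  have h2 : μ[U * Y | m] =ᵐ[μ] U * μ[Y | m] :=
    condExp_mul_of_stronglyMeasurable_left hU.stronglyMeasurable iUY (hY2.integrable (by norm_num))
  have h3 : μ[V * Z | m] =ᵐ[μ] V * μ[Z | m] :=
    condExp_mul_of_stronglyMeasurable_left hV.stronglyMeasurable iVZ (hZ2.integrable (by norm_num))
  have h4 := indep (fun x => x.1 * x.2) (by fun_prop)
  have h5 := indep (fun x => x.1) (by fun_prop)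
  have h6 := indep (fun x => x.2) (by fun_prop)
  rw [e]
  filter_upwards [condExp_add (iUV.add iUY) (iVZ.add iZY) m, condExp_add iUV iUY m,
    condExp_add iVZ iZY m, h2, h3, h4, h5, h6] with ω a1 a2 a3 a4 a5 a6 a7 a8
  have a6' : (μ[Z * Y | m]) ω = ∫ ω', Z ω' * Y ω' ∂μ := a6
  have a7' : (μ[Z | m]) ω = 0 := a7.trans hZ
  have a8' : (μ[Y | m]) ω = 0 := a8.trans hY
  rw [a1]
  simp only [Pi.add_apply, Pi.mul_apply, a2, a3, a4, a5, a6', a7', a8', h1]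
  ring

end ConditionalExpectation

/-! ### Gaussian linear forms and the conditional covariance of two increments. -/

section LinearForms

variable {Ω : Type*} [MeasurableSpace Ω] {μ : Measure Ω} {d : ℕ} {H : ℝ}
  {B : ℝ → Ω → (Fin d → ℝ)}

/-- A linear combination of the values of the `i`-th component of `B` at finitely many times. -/
def lin (B : ℝ → Ω → (Fin d → ℝ)) {n : ℕ} (τ a : Fin n → ℝ) (i : Fin d) (ω : Ω) : ℝ :=
  ∑ k, a k * B (τ k) ω i

namespace IsFBM

lemma hasGaussianLaw_clm (hB : IsFBM H B μ) {n : ℕ} {τ : Fin n → ℝ} (hτ : ∀ k, 0 ≤ τ k)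
    {F : Type*} [NormedAddCommGroup F] [NormedSpace ℝ F] [MeasurableSpace F] [BorelSpace F]
    (L : (Fin n → Fin d → ℝ) →L[ℝ] F) : HasGaussianLaw (fun ω => L fun k => B (τ k) ω) μ := by
  classical
  let σ : Fin n → Ici (0 : ℝ) := fun k => ⟨τ k, hτ k⟩
  -- The times may coincide (for instance `s + ε = t`), so the joint law is taken on the set of
  -- times and then pulled back.
  let I : Finset (Ici (0 : ℝ)) := Finset.univ.image σ
  let P : (I → Fin d → ℝ) →L[ℝ] (Fin n → Fin d → ℝ) :=
    ContinuousLinearMap.pi fun k => ContinuousLinearMap.proj ⟨σ k, by simp [I]⟩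
  exact (hB.gaussian.hasGaussianLaw I).map (L.comp P)

lemma measurable_apply (hB : IsFBM H B μ) {t : ℝ} (ht : 0 ≤ t) (i : Fin d) :
    Measurable fun ω => B t ω i := (measurable_pi_apply i).comp (hB.measurable t ht)

lemma measurable_lin (hB : IsFBM H B μ) {n : ℕ} {τ : Fin n → ℝ} (hτ : ∀ k, 0 ≤ τ k)
    (a : Fin n → ℝ) (i : Fin d) : Measurable (lin B τ a i) :=
  Finset.measurable_sum _ fun k _ => (hB.measurable_apply (hτ k) i).const_mul (a k)

lemma hasGaussianLaw_lin (hB : IsFBM H B μ) {n : ℕ} {τ : Fin n → ℝ} (hτ : ∀ k, 0 ≤ τ k)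
    (a : Fin n → ℝ) (i : Fin d) : HasGaussianLaw (lin B τ a i) μ := by
  let L : (Fin n → Fin d → ℝ) →L[ℝ] ℝ :=
    ∑ k, a k • (ContinuousLinearMap.proj (R := ℝ) (φ := fun _ : Fin d => ℝ) i).comp
      (ContinuousLinearMap.proj (R := ℝ) (φ := fun _ : Fin n => Fin d → ℝ) k)
  have : lin B τ a i = fun ω => L fun k => B (τ k) ω := by
    ext ω; simp [lin, L]
  rw [this]
  exact hB.hasGaussianLaw_clm hτ L

omit [MeasurableSpace Ω] in
lemma lin_single (t : ℝ) (i : Fin d) : lin B ![t] ![1] i = fun ω => B t ω i := by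
  ext ω; simp [lin]

lemma hasGaussianLaw_apply (hB : IsFBM H B μ) {t : ℝ} (ht : 0 ≤ t) (i : Fin d) :
    HasGaussianLaw (fun ω => B t ω i) μ := by
  rw [← lin_single]
  exact hB.hasGaussianLaw_lin (by simpa using ht) _ i

lemma memLp_apply (hB : IsFBM H B μ) {t : ℝ} (ht : 0 ≤ t) (i : Fin d) {p : ℝ≥0∞} (hp : p ≠ ∞) :
    MemLp (fun ω => B t ω i) p μ := (hB.hasGaussianLaw_apply ht i).memLp hp

lemma integral_lin (hB : IsFBM H B μ) {n : ℕ} {τ : Fin n → ℝ} (hτ : ∀ k, 0 ≤ τ k)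
    (a : Fin n → ℝ) (i : Fin d) : ∫ ω, lin B τ a i ω ∂μ = 0 := by
  have := hB.gaussian.isProbabilityMeasure
  unfold lin
  rw [integral_finsetSum]
  · refine Finset.sum_eq_zero fun k _ => ?_
    rw [integral_const_mul, hB.mean_zero _ (hτ k), mul_zero]
  · exact fun k _ => ((hB.hasGaussianLaw_apply (hτ k) i).integrable).const_mul _

lemma cov_lin_lin (hB : IsFBM H B μ) {n m : ℕ} {τ : Fin n → ℝ} {τ' : Fin m → ℝ}
    (hτ : ∀ k, 0 ≤ τ k) (hτ' : ∀ k, 0 ≤ τ' k) (a : Fin n → ℝ) (a' : Fin m → ℝ) (i j : Fin d) :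
    cov[lin B τ a i, lin B τ' a' j; μ] =
      if i = j then ∑ k, ∑ l, a k * a' l * R H (τ k) (τ' l) else 0 := by
  have := hB.gaussian.isProbabilityMeasure
  unfold lin
  rw [covariance_fun_sum_fun_sum (fun k => (hB.memLp_apply (hτ k) i (by norm_num)).const_mul _)
    (fun k => (hB.memLp_apply (hτ' k) j (by norm_num)).const_mul _)]
  simp_rw [covariance_const_mul_left, covariance_const_mul_right, hB.cov_eq _ _ (hτ _) (hτ' _)]
  split_ifs with h
  · exact Finset.sum_congr rfl fun k _ => Finset.sum_congr rfl fun l _ => by ring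
  · simp

lemma integral_lin_mul_lin (hB : IsFBM H B μ) {n m : ℕ} {τ : Fin n → ℝ} {τ' : Fin m → ℝ}
    (hτ : ∀ k, 0 ≤ τ k) (hτ' : ∀ k, 0 ≤ τ' k) (a : Fin n → ℝ) (a' : Fin m → ℝ) (i j : Fin d) :
    ∫ ω, lin B τ a i ω * lin B τ' a' j ω ∂μ =
      if i = j then ∑ k, ∑ l, a k * a' l * R H (τ k) (τ' l) else 0 := by
  have := hB.gaussian.isProbabilityMeasure
  have h := covariance_eq_sub (hB.hasGaussianLaw_lin hτ a i).memLp_two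
    (hB.hasGaussianLaw_lin hτ' a' j).memLp_two
  rw [hB.cov_lin_lin hτ hτ', hB.integral_lin hτ, zero_mul, sub_zero] at h
  exact h.symm

/-- The conditional covariance of two increments given the values at two times. -/
lemma condExp_increments (hB : IsFBM H B μ) (hH : 1 / 2 < H) (hH1 : H < 1) {s t ε δ : ℝ}
    (hs : 0 < s) (ht : 0 < t) (hst : s ≠ t) (hε : 0 < ε) (hδ : 0 < δ) (i j : Fin d) :
    μ[fun ω => (B (s + ε) ω i - B s ω i) * (B (t + δ) ω j - B t ω j) |
        MeasurableSpace.comap (fun ω => (B s ω, B t ω)) inferInstance] =ᵐ[μ] fun ω =>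
      (regL H s t (inc H s ε s) (inc H s ε t) * B s ω i
          + regR H s t (inc H s ε s) (inc H s ε t) * B t ω i)
        * (regL H s t (inc H t δ s) (inc H t δ t) * B s ω j
          + regR H s t (inc H t δ s) (inc H t δ t) * B t ω j)
      + if i = j then inc₂ H s ε t δ
          - bil H s t (regL H s t (inc H s ε s) (inc H s ε t))
              (regR H s t (inc H s ε s) (inc H s ε t))
              (regL H s t (inc H t δ s) (inc H t δ t))
              (regR H s t (inc H t δ s) (inc H t δ t))
        else 0 := by
  have := hB.gaussian.isProbabilityMeasure
  have hΘ := (Theta_pos hH hH1 hs ht hst).ne'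
  have ha1 := bil_regL (p := inc H s ε s) (r := inc H s ε t) hΘ
  have ha2 := bil_regR (p := inc H s ε s) (r := inc H s ε t) hΘ
  have hb1 := bil_regL (p := inc H t δ s) (r := inc H t δ t) hΘ
  have hb2 := bil_regR (p := inc H t δ s) (r := inc H t δ t) hΘ
  generalize regL H s t (inc H s ε s) (inc H s ε t) = a₁ at *
  generalize regR H s t (inc H s ε s) (inc H s ε t) = a₂ at *
  generalize regL H s t (inc H t δ s) (inc H t δ t) = b₁ at *
  generalize regR H s t (inc H t δ s) (inc H t δ t) = b₂ at *
  let τ : Fin 4 → ℝ := ![s, t, s + ε, t + δ]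
  have hτ : ∀ k, 0 ≤ τ k := by
    intro k; fin_cases k <;> simp [τ] <;> positivity
  -- Coefficients, on the times `s, t, s + ε, t + δ`, of the residuals of the two increments.
  let α : Fin 4 → ℝ := ![-1 - a₁, -a₂, 1, 0]
  let β : Fin 4 → ℝ := ![-b₁, -1 - b₂, 0, 1]
  -- All components at the times `s` and `t`, together with both residuals, form one linear image of
  -- a Gaussian vector; vanishing covariances then give independence from the whole conditioning
  -- pair.
  let L : (Fin 4 → Fin d → ℝ) →ₗ[ℝ] (Fin 2 × Fin d → ℝ) × (Fin 2 → ℝ) :=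
    { toFun := fun x => (fun p => x (![0, 1] p.1) p.2,
        ![∑ k, α k * x k i, ∑ k, β k * x k j])
      map_add' := fun x y => by
        refine Prod.ext rfl ?_
        ext m; fin_cases m <;> simp [mul_add, Finset.sum_add_distrib]
      map_smul' := fun c x => by
        refine Prod.ext rfl ?_
        ext m; fin_cases m <;> simp [Finset.mul_sum, mul_left_comm] }
  let X : Fin 2 × Fin d → Ω → ℝ := fun p ω => B (![s, t] p.1) ω p.2
  let Z : Fin 2 → Ω → ℝ := ![lin B τ α i, lin B τ β j]
  have hXZ : HasGaussianLaw (fun ω => (fun p => X p ω, fun m => Z m ω)) μ := by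
    have h := hB.hasGaussianLaw_clm hτ (LinearMap.toContinuousLinearMap L)
    refine h.congr (.of_forall fun ω => ?_)
    refine Prod.ext ?_ ?_
    · ext ⟨m, l⟩; fin_cases m <;> simp [X, L, τ]
    · ext m; fin_cases m <;> simp [Z, L, lin]
  have hst0 : ∀ m : Fin 2, 0 ≤ (![s, t] : Fin 2 → ℝ) m := by
    intro m; fin_cases m <;> simp [hs.le, ht.le]
  have hcov : ∀ p m, cov[X p, Z m; μ] = 0 := by
    rintro ⟨m, l⟩ m'
    have e : X (m, l) = lin B ![(![s, t] : Fin 2 → ℝ) m] ![1] l := by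
      rw [lin_single]
    have hone : ∀ k : Fin 1, 0 ≤ (![(![s, t] : Fin 2 → ℝ) m] : Fin 1 → ℝ) k := by
      simpa using hst0 m
    have hZl : ∀ (γ : Fin 4 → ℝ) (q : Fin d),
        ∑ k, γ k * R H (![s, t] m) (τ k) = 0 → cov[X (m, l), lin B τ γ q; μ] = 0 := by
      intro γ q h
      rw [e, hB.cov_lin_lin hone hτ]
      simpa using fun _ => h
    have hα : ∑ k, α k * R H (![s, t] m) (τ k) = 0 := by
      simp only [Fin.sum_univ_four]
      fin_cases m <;> simp [α, τ]
      · rw [R_comm H s t, R_comm H s (s + ε)]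
        rw [R_comm H s t] at ha1
        unfold inc v at *
        linarith
      · rw [R_comm H t s, R_comm H t (s + ε)]
        unfold inc v at *
        linarith
    have hβ : ∑ k, β k * R H (![s, t] m) (τ k) = 0 := by
      simp only [Fin.sum_univ_four]
      fin_cases m <;> simp [β, τ]
      · rw [R_comm H s (t + δ)]
        rw [R_comm H s t] at *
        unfold inc v at *
        linarith
      · rw [R_comm H t s, R_comm H t (t + δ)]
        unfold inc v at *
        linarith
    fin_cases m'
    · exact hZl α i hα
    · exact hZl β j hβ
  have hind := hXZ.indepFun_of_covariance_eval hcov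
  let φ : (Fin 2 × Fin d → ℝ) → (Fin d → ℝ) × (Fin d → ℝ) :=
    fun x => (fun l => x (0, l), fun l => x (1, l))
  have hφ : Measurable φ := by fun_prop
  let ψ : (Fin 2 → ℝ) → ℝ × ℝ := fun x => (x 0, x 1)
  have hψ : Measurable ψ := by fun_prop
  have hind' : IndepFun (fun ω => (B s ω, B t ω)) (fun ω => (lin B τ α i ω, lin B τ β j ω)) μ :=
    hind.comp hφ hψ
  have hP : Measurable fun ω => (B s ω, B t ω) :=
    (hB.measurable s hs.le).prodMk (hB.measurable t ht.le)
  have hmeas : ∀ (c e : ℝ) (l : Fin d),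
      Measurable[MeasurableSpace.comap (fun ω => (B s ω, B t ω)) inferInstance]
        fun ω => c * B s ω l + e * B t ω l := by
    intro c e l
    have hg : Measurable fun x : (Fin d → ℝ) × (Fin d → ℝ) => c * x.1 l + e * x.2 l := by fun_prop
    exact hg.comp (comap_measurable _)
  have hL2 : ∀ (c e : ℝ) (l : Fin d), MemLp (fun ω => c * B s ω l + e * B t ω l) 2 μ :=
    fun c e l => ((hB.memLp_apply hs.le l (by norm_num)).const_mul c).add
      ((hB.memLp_apply ht.le l (by norm_num)).const_mul e)
  have main := condExp_add_mul_add_of_indepFun (μ := μ) hP (hmeas a₁ a₂ i) (hmeas b₁ b₂ j)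
    (hB.measurable_lin hτ α i) (hB.measurable_lin hτ β j) (hL2 a₁ a₂ i) (hL2 b₁ b₂ j)
    (hB.hasGaussianLaw_lin hτ α i).memLp_two (hB.hasGaussianLaw_lin hτ β j).memLp_two
    hind' (hB.integral_lin hτ α i) (hB.integral_lin hτ β j)
  have e1 : (fun ω => (B (s + ε) ω i - B s ω i) * (B (t + δ) ω j - B t ω j)) =
      fun ω => (a₁ * B s ω i + a₂ * B t ω i + lin B τ α i ω)
        * (b₁ * B s ω j + b₂ * B t ω j + lin B τ β j ω) := by
    ext ω
    simp only [lin, Fin.sum_univ_four, α, β, τ]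
    simp
    ring
  -- By the normal equations, the covariance of the residuals is that of the increments minus that
  -- of the regressions.
  have e2 : ∫ ω, lin B τ α i ω * lin B τ β j ω ∂μ =
      if i = j then inc₂ H s ε t δ - bil H s t a₁ a₂ b₁ b₂ else 0 := by
    rw [hB.integral_lin_mul_lin hτ hτ]
    congr 1
    simp only [Fin.sum_univ_four, α, β, τ]
    simp
    have c1 := R_comm H t s
    have c2 := R_comm H t (s + ε)
    have c4 := R_comm H s (t + δ)
    have c5 := R_comm H t (t + δ)
    have c6 := R_comm H (t + δ) (s + ε)
    unfold inc₂ bil inc v at *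
    simp only [c1, c2, c4, c5, c6] at ha1 ha2 hb1 hb2 ⊢
    linear_combination b₁ * ha1 + b₂ * ha2 + a₁ * hb1 + a₂ * hb2
  rw [e1]
  filter_upwards [main] with ω hω
  rw [hω, e2]

end IsFBM

end LinearForms

/-! ### Reduction of matrix norms to entries. -/

section MatrixNorm

variable {m n : Type*} [Fintype m] [Fintype n]

lemma norm_le_sum_norm_entries (A : Matrix m n ℝ) : ‖A‖ ≤ ∑ i, ∑ j, ‖A i j‖ := by
  have h0 : 0 ≤ ∑ i, ∑ j, ‖A i j‖ := by positivity
  have h : ∑ i, ∑ j, ‖A i j‖ ^ (2 : ℝ) ≤ (∑ i, ∑ j, ‖A i j‖) ^ (2 : ℝ) := by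
    simp only [Real.rpow_two, ← Finset.sum_product']
    exact Finset.sum_sq_le_sq_sum_of_nonneg fun p _ => norm_nonneg _
  rw [Matrix.frobenius_norm_def]
  calc _ ≤ ((∑ i, ∑ j, ‖A i j‖) ^ (2 : ℝ)) ^ (1 / 2 : ℝ) :=
        Real.rpow_le_rpow (by positivity) h (by norm_num)
    _ = _ := by rw [← Real.rpow_mul h0]; norm_num

lemma eLpNorm_le_sum_entries {Ω : Type*} [MeasurableSpace Ω] {μ : Measure Ω}
    {M : Ω → Matrix m n ℝ} {q : ℝ≥0∞} (hq : 1 ≤ q)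
    (hM : ∀ i j, AEStronglyMeasurable (fun ω => M ω i j) μ) :
    eLpNorm M q μ ≤ ∑ i, ∑ j, eLpNorm (fun ω => M ω i j) q μ := by
  have h1 : eLpNorm M q μ ≤ eLpNorm (∑ i, ∑ j, fun ω => ‖M ω i j‖) q μ := by
    refine eLpNorm_mono_real fun ω => ?_
    simpa using norm_le_sum_norm_entries (M ω)
  refine h1.trans ((eLpNorm_sum_le (fun i _ => ?_) hq).trans ?_)
  · exact Finset.aestronglyMeasurable_sum _ fun j _ => (hM i j).norm
  · refine Finset.sum_le_sum fun i _ => (eLpNorm_sum_le (fun j _ => (hM i j).norm) hq).trans ?_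
    exact Finset.sum_le_sum fun j _ => (eLpNorm_norm _).le

end MatrixNorm

/-! ### The quadratic matrix field built from two regressions. -/

section RegressionField

variable {d : ℕ}

/-- The matrix `x ⊗ y - ρ I`. -/
def centred (ρ : ℝ) (x y : Fin d → ℝ) : Matrix (Fin d) (Fin d) ℝ :=
  Matrix.vecMulVec x y - ρ • (1 : Matrix (Fin d) (Fin d) ℝ)

/-- The centred tensor product of the regressions on `x = B_s`, `y = B_t` of two variables with
covariances `p`, `r` and `p'`, `r'`, plus `k I`. -/
noncomputable def regField (H s t p r p' r' k : ℝ) (x y : Fin d → ℝ) :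
    Matrix (Fin d) (Fin d) ℝ :=
  (regL H s t p r * regL H s t p' r') • centred (v H s) x x
    + (regL H s t p r * regR H s t p' r') • centred (R H s t) x y
    + (regR H s t p r * regL H s t p' r') • centred (R H s t) y x
    + (regR H s t p r * regR H s t p' r') • centred (v H t) y y
    + k • (1 : Matrix (Fin d) (Fin d) ℝ)

/-- The four centring constants add up to the covariance of the two regressions. This links the
expanded form of `𝒲` to the product form given by conditioning. -/
lemma regField_apply (H s t p r p' r' k : ℝ) (x y : Fin d → ℝ) (i j : Fin d) :
    regField H s t p r p' r' k x y i j =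
      (regL H s t p r * x i + regR H s t p r * y i)
        * (regL H s t p' r' * x j + regR H s t p' r' * y j)
      + if i = j then k - bil H s t (regL H s t p r) (regR H s t p r)
          (regL H s t p' r') (regR H s t p' r') else 0 := by
  simp only [regField, centred, Matrix.add_apply, Matrix.smul_apply, Matrix.sub_apply,
    Matrix.vecMulVec_apply, Matrix.one_apply, smul_eq_mul, bil]
  split_ifs <;> ring

lemma continuous_centred (ρ : ℝ) :
    Continuous fun z : (Fin d → ℝ) × (Fin d → ℝ) => centred ρ z.1 z.2 :=
  (continuous_fst.matrix_vecMulVec continuous_snd).sub continuous_const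

lemma regL_div (H s t p r c : ℝ) : regL H s t (p / c) (r / c) = regL H s t p r / c := by
  unfold regL; ring

lemma regR_div (H s t p r c : ℝ) : regR H s t (p / c) (r / c) = regR H s t p r / c := by
  unfold regR; ring

/-- The normalized conditional covariance as an explicit function of `B_s` and `B_t`. -/
noncomputable def condField (H ε δ s t : ℝ) (x y : Fin d → ℝ) : Matrix (Fin d) (Fin d) ℝ :=
  regField H s t (inc H s ε s / ε) (inc H s ε t / ε) (inc H t δ s / δ) (inc H t δ t / δ)
    (inc₂ H s ε t δ / (ε * δ)) x y

/-- The limit of `condField` as the increments shrink. -/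
noncomputable def limField (H s t : ℝ) (x y : Fin d → ℝ) : Matrix (Fin d) (Fin d) ℝ :=
  regField H s t (dR H s s) (dR H s t) (dR H t s) (dR H t t) (ddR H s t) x y

end RegressionField

/-! ### Gaussian moment bounds and convergence at fixed times. -/

section Moments

lemma bil_self_nonneg {H s t : ℝ} (hH : 0 < H) (hs : 0 < s) (hΘ : 0 ≤ Theta H s t) (a b : ℝ) :
    0 ≤ bil H s t a b a b := by
  have h1 : 0 < v H s := by rw [v_eq hH]; positivity
  refine nonneg_of_mul_nonneg_right (a := v H s) ?_ h1
  have e : v H s * bil H s t a b a b = (a * v H s + b * R H s t) ^ 2 + b ^ 2 * Theta H s t := by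
    rw [Theta_eq, bil]; ring
  rw [e]
  positivity

lemma holderTriple_two_mul (q : ℝ≥0∞) : ENNReal.HolderTriple (2 * q) (2 * q) q := by
  constructor
  rw [ENNReal.mul_inv (by simp) (by simp), ← two_mul, ← mul_assoc,
    ENNReal.mul_inv_cancel (by simp) (by simp), one_mul]

lemma tendsto_eLpNorm_sum_smul {Ω E κ ι : Type*} [MeasurableSpace Ω] {μ : Measure Ω}
    [NormedAddCommGroup E] [NormedSpace ℝ E] [Fintype κ] {q : ℝ≥0∞} (hq : 1 ≤ q)
    {N : κ → Ω → E} (hN : ∀ k, MemLp (N k) q μ) {l : Filter ι} {c : κ → ι → ℝ} {c₀ : κ → ℝ}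
    (hc : ∀ k, Tendsto (c k) l (𝓝 (c₀ k))) :
    Tendsto (fun n => eLpNorm (fun ω => ∑ k, (c k n - c₀ k) • N k ω) q μ) l (𝓝 0) := by
  have lim : Tendsto (fun n => ∑ k, eLpNorm ((c k n - c₀ k) • N k) q μ) l (𝓝 0) := by
    rw [← Finset.sum_const_zero (s := (Finset.univ : Finset κ))]
    refine tendsto_finsetSum _ fun k _ => ?_
    simp_rw [eLpNorm_const_smul]
    have h1 : Tendsto (fun n => ‖c k n - c₀ k‖ₑ) l (𝓝 0) := by
      simpa using ((hc k).sub_const (c₀ k)).enorm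
    simpa using ENNReal.Tendsto.mul_const h1 (.inr (hN k).eLpNorm_ne_top)
  refine tendsto_of_tendsto_of_tendsto_of_le_of_le tendsto_const_nhds lim
    (fun _ => zero_le) fun n => ?_
  have e : (fun ω => ∑ k, (c k n - c₀ k) • N k ω) = ∑ k, (c k n - c₀ k) • N k := by
    ext ω; simp
  rw [e]
  exact eLpNorm_sum_le (fun k _ => (hN k).1.const_smul _) hq

variable {Ω : Type*} [MeasurableSpace Ω] {μ : Measure Ω} {d : ℕ} {H : ℝ}
  {B : ℝ → Ω → (Fin d → ℝ)}

/-- The `L^p` norm of a standard Gaussian variable. -/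
noncomputable def gaussNorm (p : ℝ≥0∞) : ℝ≥0∞ := eLpNorm id p (gaussianReal 0 1)

lemma gaussNorm_ne_top {p : ℝ≥0∞} (hp : p ≠ ∞) : gaussNorm p ≠ ∞ :=
  (memLp_id_gaussianReal' p hp).eLpNorm_ne_top

lemma eLpNorm_of_hasGaussianLaw {X : Ω → ℝ} (hX : HasGaussianLaw X μ) (h0 : ∫ ω, X ω ∂μ = 0)
    (p : ℝ≥0∞) : eLpNorm X p μ = ENNReal.ofReal (√(Var[X; μ])) * gaussNorm p := by
  have hmap : μ.map X = (gaussianReal 0 1).map (√(Var[X; μ]) * ·) := by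
    rw [hX.map_eq_gaussianReal, gaussianReal_map_const_mul, h0, mul_zero]
    congr 1
    ext
    simp [variance_nonneg]
  have h1 : eLpNorm X p μ = eLpNorm id p (μ.map X) := by
    rw [eLpNorm_map_measure aestronglyMeasurable_id hX.aemeasurable]; rfl
  rw [h1, hmap, eLpNorm_map_measure aestronglyMeasurable_id (by fun_prop)]
  have : (id ∘ (√(Var[X; μ]) * ·) : ℝ → ℝ) = √(Var[X; μ]) • id := by ext; simp
  rw [this, eLpNorm_const_smul, gaussNorm, Real.enorm_eq_ofReal (Real.sqrt_nonneg _)]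

namespace IsFBM

omit [MeasurableSpace Ω] in
lemma lin_pair (s t a b : ℝ) (i : Fin d) :
    lin B ![s, t] ![a, b] i = fun ω => a * B s ω i + b * B t ω i := by
  ext ω; simp [lin]

lemma eLpNorm_pair (hB : IsFBM H B μ) {s t : ℝ} (hs : 0 ≤ s) (ht : 0 ≤ t) (a b : ℝ) (i : Fin d)
    (p : ℝ≥0∞) : eLpNorm (fun ω => a * B s ω i + b * B t ω i) p μ =
      ENNReal.ofReal (√(bil H s t a b a b)) * gaussNorm p := by
  have hτ : ∀ k : Fin 2, 0 ≤ (![s, t] : Fin 2 → ℝ) k := by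
    intro k; fin_cases k <;> simp [hs, ht]
  rw [← lin_pair, eLpNorm_of_hasGaussianLaw (hB.hasGaussianLaw_lin hτ _ i)
    (hB.integral_lin hτ _ i), ← covariance_self (hB.measurable_lin hτ _ i).aemeasurable,
    hB.cov_lin_lin hτ hτ]
  congr 3
  simp [Fin.sum_univ_two, bil, v, R_comm H t s]
  ring

lemma aestronglyMeasurable_pair (hB : IsFBM H B μ) {s t : ℝ} (hs : 0 ≤ s) (ht : 0 ≤ t) (a b : ℝ)
    (i : Fin d) : AEStronglyMeasurable (fun ω => a * B s ω i + b * B t ω i) μ :=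
  (((hB.measurable_apply hs i).const_mul a).add
    ((hB.measurable_apply ht i).const_mul b)).aestronglyMeasurable

/-- The constant in the moment bound for quadratic functions of Gaussian variables. -/
noncomputable def fieldConst (d : ℕ) (q : ℝ≥0∞) : ℝ≥0∞ :=
  ∑ _ : Fin d, ∑ _ : Fin d, (gaussNorm (2 * q) * gaussNorm (2 * q) + 2)

lemma fieldConst_ne_top {d : ℕ} {q : ℝ≥0∞} (hq : q ≠ ∞) : fieldConst d q ≠ ∞ := by
  have := gaussNorm_ne_top (p := 2 * q) (ENNReal.mul_ne_top (by norm_num) hq)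
  simp only [fieldConst, Finset.sum_const, nsmul_eq_mul]
  finiteness

/-- Each entry is a product of two Gaussian variables plus a constant. Hölder with exponents `2 q, 2
q` bounds the product, and Cauchy–Schwarz for `bil` bounds the constant by `2 * D`. -/
lemma eLpNorm_regField_le (hB : IsFBM H B μ) (hH : 0 < H) {q : ℝ≥0∞} (hq : 1 ≤ q) {s t : ℝ}
    (hs : 0 < s) (ht : 0 ≤ t) (hΘ : 0 ≤ Theta H s t) {p r p' r' k D : ℝ}
    (h : regVar H s t p r ≤ D) (h' : regVar H s t p' r' ≤ D) (hk : |k| ≤ D) :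
    eLpNorm (fun ω => regField H s t p r p' r' k (B s ω) (B t ω)) q μ
      ≤ fieldConst d q * ENNReal.ofReal D := by
  have := hB.gaussian.isProbabilityMeasure
  have hD : 0 ≤ D := (abs_nonneg k).trans hk
  have hent : ∀ i j, (fun ω => regField H s t p r p' r' k (B s ω) (B t ω) i j) =
      (fun ω => regL H s t p r * B s ω i + regR H s t p r * B t ω i)
        • (fun ω => regL H s t p' r' * B s ω j + regR H s t p' r' * B t ω j)
      + fun _ => if i = j then k - bil H s t (regL H s t p r) (regR H s t p r)
          (regL H s t p' r') (regR H s t p' r') else 0 := by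
    intro i j; ext ω; rw [regField_apply]; rfl
  have m1 := fun i => hB.aestronglyMeasurable_pair hs.le ht (regL H s t p r) (regR H s t p r) i
  have m2 := fun i => hB.aestronglyMeasurable_pair hs.le ht (regL H s t p' r') (regR H s t p' r') i
  have hsq : ENNReal.ofReal √D * ENNReal.ofReal √D = ENNReal.ofReal D := by
    rw [← ENNReal.ofReal_mul (Real.sqrt_nonneg _), Real.mul_self_sqrt hD]
  have := holderTriple_two_mul q
  refine (eLpNorm_le_sum_entries hq fun i j => ?_).trans ?_
  · rw [hent]; exact ((m1 i).smul (m2 j)).add aestronglyMeasurable_const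
  rw [fieldConst, Finset.sum_mul]
  refine Finset.sum_le_sum fun i _ => ?_
  rw [Finset.sum_mul]
  refine Finset.sum_le_sum fun j _ => ?_
  rw [hent]
  refine (eLpNorm_add_le ((m1 i).smul (m2 j)) aestronglyMeasurable_const hq).trans ?_
  rw [add_mul]
  refine add_le_add ?_ ?_
  · refine (eLpNorm_smul_le_mul_eLpNorm (p := 2 * q) (q := 2 * q) (m2 j) (m1 i)).trans ?_
    rw [hB.eLpNorm_pair hs.le ht, hB.eLpNorm_pair hs.le ht, mul_mul_mul_comm, mul_comm, ← hsq]
    gcongr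
    · exact h
    · exact h'
  · have hb := bil_sq_le hΘ (regL H s t p r) (regR H s t p r) (regL H s t p' r') (regR H s t p' r')
    have hbD : |bil H s t (regL H s t p r) (regR H s t p r) (regL H s t p' r')
        (regR H s t p' r')| ≤ D := by
      refine abs_le_of_sq_le_sq (hb.trans ?_) hD
      rw [sq]
      exact mul_le_mul h h' (bil_self_nonneg hH hs hΘ _ _) hD
    rw [eLpNorm_const _ (by positivity) (NeZero.ne μ), measure_univ, ENNReal.one_rpow, mul_one,
      Real.enorm_eq_ofReal_abs, show (2 : ℝ≥0∞) = ENNReal.ofReal 2 by simp,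
      ← ENNReal.ofReal_mul zero_le_two]
    refine ENNReal.ofReal_le_ofReal ?_
    split_ifs
    · refine (abs_sub _ _).trans ?_
      linarith
    · simpa using hD

/-- At fixed times the field is a combination of five fixed matrices in `L^q`; only the scalar
coefficients vary. -/
lemma tendsto_eLpNorm_regField (hB : IsFBM H B μ) {q : ℝ≥0∞} (hq : 1 ≤ q) (hq' : q ≠ ∞) {s t : ℝ}
    (hs : 0 ≤ s) (ht : 0 ≤ t) {ι : Type*} {l : Filter ι} {p r p' r' k : ι → ℝ}
    {p₀ r₀ p₀' r₀' k₀ : ℝ} (hp : Tendsto p l (𝓝 p₀)) (hr : Tendsto r l (𝓝 r₀))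
    (hp' : Tendsto p' l (𝓝 p₀')) (hr' : Tendsto r' l (𝓝 r₀')) (hk : Tendsto k l (𝓝 k₀)) :
    Tendsto (fun n => eLpNorm (fun ω => regField H s t (p n) (r n) (p' n) (r' n) (k n) (B s ω)
      (B t ω) - regField H s t p₀ r₀ p₀' r₀' k₀ (B s ω) (B t ω)) q μ) l (𝓝 0) := by
  have := hB.gaussian.isProbabilityMeasure
  have hN : ∀ (ρ u w : ℝ), 0 ≤ u → 0 ≤ w → MemLp (fun ω => centred ρ (B u ω) (B w ω)) q μ := by
    intro ρ u w hu hw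
    have hent : ∀ i j, MemLp (fun ω => centred ρ (B u ω) (B w ω) i j) q μ := by
      intro i j
      have := holderTriple_two_mul q
      have h2q : 2 * q ≠ ∞ := ENNReal.mul_ne_top (by norm_num) hq'
      have h1 := (hB.memLp_apply hw j h2q).mul (r := q) (hB.memLp_apply hu i h2q)
      exact h1.sub (memLp_const ((ρ • (1 : Matrix (Fin d) (Fin d) ℝ)) i j))
    refine ⟨(continuous_centred ρ).comp_aestronglyMeasurable
      ((hB.measurable u hu).prodMk (hB.measurable w hw)).aestronglyMeasurable, ?_⟩
    refine (eLpNorm_le_sum_entries hq fun i j => (hent i j).1).trans_lt ?_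
    exact ENNReal.sum_lt_top.2 fun i _ => ENNReal.sum_lt_top.2 fun j _ => (hent i j).2
  have hL : Tendsto (fun n => regL H s t (p n) (r n)) l (𝓝 (regL H s t p₀ r₀)) :=
    ((hp.mul_const _).sub (hr.const_mul _)).div_const _
  have hR : Tendsto (fun n => regR H s t (p n) (r n)) l (𝓝 (regR H s t p₀ r₀)) :=
    ((hr.mul_const _).sub (hp.const_mul _)).div_const _
  have hL' : Tendsto (fun n => regL H s t (p' n) (r' n)) l (𝓝 (regL H s t p₀' r₀')) :=
    ((hp'.mul_const _).sub (hr'.const_mul _)).div_const _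
  have hR' : Tendsto (fun n => regR H s t (p' n) (r' n)) l (𝓝 (regR H s t p₀' r₀')) :=
    ((hr'.mul_const _).sub (hp'.const_mul _)).div_const _
  have main := tendsto_eLpNorm_sum_smul (μ := μ) (E := Matrix (Fin d) (Fin d) ℝ) hq
    (N := ![fun ω => centred (v H s) (B s ω) (B s ω), fun ω => centred (R H s t) (B s ω) (B t ω),
      fun ω => centred (R H s t) (B t ω) (B s ω), fun ω => centred (v H t) (B t ω) (B t ω),
      fun _ => 1])
    (c := ![_, _, _, _, k]) (c₀ := ![_, _, _, _, k₀]) (l := l) (by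
      intro m
      fin_cases m
      · exact hN _ _ _ hs hs
      · exact hN _ _ _ hs ht
      · exact hN _ _ _ ht hs
      · exact hN _ _ _ ht ht
      · exact memLp_const _)
    (by
      intro m
      fin_cases m
      · exact hL.mul hL'
      · exact hL.mul hR'
      · exact hR.mul hL'
      · exact hR.mul hR'
      · exact hk)
  refine main.congr fun n => ?_
  congr 1
  ext1 ω
  simp only [Fin.sum_univ_five, regField]
  simp only [Matrix.cons_val]
  module

/-- Since `v' / 2` is `dR` on the diagonal, the λ's are regression coefficients for the covariances
`dR`, the formal covariances of the derivative of `B`. -/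
lemma Lam_eq (hB : IsFBM H B μ) (hH : 1 / 2 < H) {s t : ℝ} (hs : 0 ≤ s) (ht : 0 ≤ t) (ω : Ω) :
    Lam H B μ (ω, (s, t)) = limField H s t (B s ω) (B t ω) := by
  have h11 : lambda11 H s t = regL H s t (dR H s s) (dR H s t) := by
    rw [lambda11, deriv_v hH, regL]; ring
  have h12 : lambda12 H s t = regR H s t (dR H s s) (dR H s t) := by
    rw [lambda12, deriv_v hH, regR]; ring
  have h21 : lambda21 H s t = regL H s t (dR H t s) (dR H t t) := by
    rw [lambda21, deriv_v hH, regL]; ring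
  have h22 : lambda22 H s t = regR H s t (dR H t s) (dR H t t) := by
    rw [lambda22, deriv_v hH, regR]; ring
  ext i j
  rw [limField, regField_apply]
  simp only [Lam, W, Matrix.add_apply, Matrix.smul_apply, Matrix.of_apply, Matrix.one_apply,
    smul_eq_mul, hB.cov_eq _ _ hs hs, hB.cov_eq _ _ hs ht, hB.cov_eq _ _ ht hs,
    hB.cov_eq _ _ ht ht, h11, h12, h21, h22, bil, R_comm H t s, v]
  split_ifs <;> ring

lemma condExp_eq_condField (hB : IsFBM H B μ) (hH : 1 / 2 < H) (hH1 : H < 1) {s t ε δ : ℝ}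
    (hs : 0 < s) (ht : 0 < t) (hst : s ≠ t) (hε : 0 < ε) (hδ : 0 < δ) (i j : Fin d) :
    (fun ω => condField H ε δ s t (B s ω) (B t ω) i j) =ᵐ[μ] fun ω => 1 / (ε * δ) *
      (μ[fun ω => (B (s + ε) ω i - B s ω i) * (B (t + δ) ω j - B t ω j) |
        MeasurableSpace.comap (fun ω => (B s ω, B t ω)) inferInstance]) ω := by
  filter_upwards [hB.condExp_increments hH hH1 hs ht hst hε hδ i j] with ω hω
  rw [hω, condField, regField_apply, regL_div, regR_div, regL_div, regR_div]
  unfold bil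
  split_ifs <;> (field_simp; try ring)

end IsFBM

end Moments

/-! ### From sections at fixed times to the product space. -/

section ProductMeasure

variable {Ω Z E : Type*} [MeasurableSpace Ω] [MeasurableSpace Z] [NormedAddCommGroup E]
  {μ : Measure Ω} {ν : Measure Z} [SFinite μ] [SFinite ν] {q : ℝ≥0∞}

/-- Tonelli. It is needed because conditional expectations are determined only almost surely for
each pair of times. -/
lemma ae_eq_prod_of_sections {f g : Ω × Z → E} (hf : AEStronglyMeasurable f (μ.prod ν))
    (hg : AEStronglyMeasurable g (μ.prod ν))
    (h : ∀ᵐ z ∂ν, (fun ω => f (ω, z)) =ᵐ[μ] fun ω => g (ω, z)) : f =ᵐ[μ.prod ν] g := by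
  have h0 : ∫⁻ x, ‖(f - g) x‖ₑ ∂(μ.prod ν) = 0 := by
    rw [lintegral_prod_symm _ (hf.sub hg).enorm]
    refine lintegral_eq_zero_of_ae_eq_zero ?_
    filter_upwards [h] with z hz
    refine lintegral_eq_zero_of_ae_eq_zero ?_
    filter_upwards [hz] with ω hω
    simp [hω]
  rw [lintegral_eq_zero_iff' (hf.sub hg).enorm] at h0
  filter_upwards [h0] with x hx
  simpa [sub_eq_zero] using hx

lemma eLpNorm_prod_eq (hq0 : q ≠ 0) (hq : q ≠ ∞) {f : Ω × Z → E}
    (hf : AEStronglyMeasurable f (μ.prod ν)) :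
    eLpNorm f q (μ.prod ν) =
      (∫⁻ z, eLpNorm (fun ω => f (ω, z)) q μ ^ q.toReal ∂ν) ^ (1 / q.toReal) := by
  have hq' : 0 < q.toReal := ENNReal.toReal_pos hq0 hq
  rw [eLpNorm_eq_lintegral_rpow_enorm_toReal hq0 hq,
    lintegral_prod_symm _ (hf.enorm.pow_const _)]
  congr 1
  refine lintegral_congr fun z => ?_
  rw [eLpNorm_eq_lintegral_rpow_enorm_toReal hq0 hq, ← ENNReal.rpow_mul,
    one_div_mul_cancel hq'.ne', ENNReal.rpow_one]

lemma aemeasurable_eLpNorm_section (hq0 : q ≠ 0) (hq : q ≠ ∞) {f : Ω × Z → E}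
    (hf : AEStronglyMeasurable f (μ.prod ν)) :
    AEMeasurable (fun z => eLpNorm (fun ω => f (ω, z)) q μ) ν := by
  simp_rw [eLpNorm_eq_lintegral_rpow_enorm_toReal hq0 hq]
  exact ((hf.enorm.pow_const _).lintegral_prod_left').pow_const _

omit [SFinite ν] in
lemma lintegral_const_mul_enorm_rpow_ne_top (hq0 : q ≠ 0) (hq : q ≠ ∞) {g : Z → ℝ}
    (hg : MemLp g q ν) {K : ℝ≥0∞} (hK : K ≠ ∞) :
    ∫⁻ z, (K * ‖g z‖ₑ) ^ q.toReal ∂ν ≠ ∞ := by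
  have h := lintegral_rpow_enorm_lt_top_of_eLpNorm_lt_top hq0 hq hg.2
  simp_rw [ENNReal.mul_rpow_of_nonneg _ _ ENNReal.toReal_nonneg]
  rw [lintegral_const_mul' _ _ (ENNReal.rpow_ne_top_of_nonneg ENNReal.toReal_nonneg hK)]
  exact ENNReal.mul_ne_top (ENNReal.rpow_ne_top_of_nonneg ENNReal.toReal_nonneg hK) h.ne

lemma memLp_prod_of_section_le (hq0 : q ≠ 0) (hq : q ≠ ∞) {f : Ω × Z → E}
    (hf : AEStronglyMeasurable f (μ.prod ν)) {g : Z → ℝ} (hg : MemLp g q ν) {K : ℝ≥0∞}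
    (hK : K ≠ ∞) (hle : ∀ᵐ z ∂ν, eLpNorm (fun ω => f (ω, z)) q μ ≤ K * ‖g z‖ₑ) :
    MemLp f q (μ.prod ν) := by
  refine ⟨hf, ?_⟩
  rw [eLpNorm_prod_eq hq0 hq hf]
  refine ENNReal.rpow_lt_top_of_nonneg (by positivity) (ne_top_of_le_ne_top
    (lintegral_const_mul_enorm_rpow_ne_top hq0 hq hg hK) (lintegral_mono_ae ?_))
  filter_upwards [hle] with z hz
  exact ENNReal.rpow_le_rpow hz ENNReal.toReal_nonneg

/-- Dominated convergence for the `q`-th powers of the section norms. -/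
lemma tendsto_eLpNorm_prod (hq0 : q ≠ 0) (hq : q ≠ ∞) {ι : Type*} {l : Filter ι}
    [l.IsCountablyGenerated] {f : ι → Ω × Z → E}
    (hf : ∀ᶠ n in l, AEStronglyMeasurable (f n) (μ.prod ν)) {g : Z → ℝ} (hg : MemLp g q ν)
    {K : ℝ≥0∞} (hK : K ≠ ∞)
    (hle : ∀ᶠ n in l, ∀ᵐ z ∂ν, eLpNorm (fun ω => f n (ω, z)) q μ ≤ K * ‖g z‖ₑ)
    (hlim : ∀ᵐ z ∂ν, Tendsto (fun n => eLpNorm (fun ω => f n (ω, z)) q μ) l (𝓝 0)) :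
    Tendsto (fun n => eLpNorm (f n) q (μ.prod ν)) l (𝓝 0) := by
  have hq' : 0 < q.toReal := ENNReal.toReal_pos hq0 hq
  have h1 : Tendsto (fun n => ∫⁻ z, eLpNorm (fun ω => f n (ω, z)) q μ ^ q.toReal ∂ν) l
      (𝓝 (∫⁻ _, 0 ∂ν)) := by
    refine tendsto_lintegral_filter_of_dominated_convergence'
      (fun z => (K * ‖g z‖ₑ) ^ q.toReal) ?_ ?_
      (lintegral_const_mul_enorm_rpow_ne_top hq0 hq hg hK) ?_
    · filter_upwards [hf] with n hn
      exact (aemeasurable_eLpNorm_section hq0 hq hn).pow_const _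
    · filter_upwards [hle] with n hn
      filter_upwards [hn] with z hz
      exact ENNReal.rpow_le_rpow hz ENNReal.toReal_nonneg
    · filter_upwards [hlim] with z hz
      simpa [ENNReal.zero_rpow_of_pos hq'] using hz.ennrpow_const q.toReal
  rw [lintegral_zero] at h1
  have h2 := h1.ennrpow_const (1 / q.toReal)
  rw [ENNReal.zero_rpow_of_pos (by positivity)] at h2
  refine h2.congr' ?_
  filter_upwards [hf] with n hn
  rw [eLpNorm_prod_eq hq0 hq hn]

/-- Dominated convergence in `L^q` of a product: domination and convergence of the `L^q` norms of
the sections. -/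
lemma memLp_and_tendsto_of_sections (hq1 : 1 ≤ q) (hq : q ≠ ∞) {ι : Type*} {l : Filter ι}
    [l.IsCountablyGenerated] [l.NeBot] {P : ι → Prop} (hP : ∀ᶠ n in l, P n)
    {f : ι → Ω × Z → E} {f₀ : Ω × Z → E}
    (hf : ∀ n, P n → AEStronglyMeasurable (f n) (μ.prod ν))
    (hf₀ : AEStronglyMeasurable f₀ (μ.prod ν)) {g : Z → ℝ} (hg : MemLp g q ν)
    {K : ℝ≥0∞} (hK : K ≠ ∞)
    (hm : ∀ᵐ z ∂ν, ∀ n, P n → AEStronglyMeasurable (fun ω => f n (ω, z)) μ)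
    (hm₀ : ∀ᵐ z ∂ν, AEStronglyMeasurable (fun ω => f₀ (ω, z)) μ)
    (hle : ∀ᵐ z ∂ν, ∀ n, P n → eLpNorm (fun ω => f n (ω, z)) q μ ≤ K * ‖g z‖ₑ)
    (hlim : ∀ᵐ z ∂ν,
      Tendsto (fun n => eLpNorm (fun ω => f n (ω, z) - f₀ (ω, z)) q μ) l (𝓝 0)) :
    (∀ n, P n → MemLp (f n) q (μ.prod ν)) ∧ MemLp f₀ q (μ.prod ν) ∧
      Tendsto (fun n => eLpNorm (fun x => f n x - f₀ x) q (μ.prod ν)) l (𝓝 0) := by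
  have hq0 : q ≠ 0 := (zero_lt_one.trans_le hq1).ne'
  -- The domination passes to the limit field by the triangle inequality, so the differences are
  -- dominated with constant `K + K`.
  have hle₀ : ∀ᵐ z ∂ν, eLpNorm (fun ω => f₀ (ω, z)) q μ ≤ K * ‖g z‖ₑ := by
    filter_upwards [hm, hm₀, hle, hlim] with z h1 h2 h3 h4
    have h5 : Tendsto (fun n => K * ‖g z‖ₑ + eLpNorm (fun ω => f n (ω, z) - f₀ (ω, z)) q μ) l
        (𝓝 (K * ‖g z‖ₑ)) := by simpa using h4.const_add (K * ‖g z‖ₑ)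
    refine ge_of_tendsto h5 ?_
    filter_upwards [hP] with n hn
    have e : (fun ω => f₀ (ω, z))
        = (fun ω => f n (ω, z)) - fun ω => f n (ω, z) - f₀ (ω, z) := by
      ext ω; simp
    rw [e]
    exact (eLpNorm_sub_le (h1 n hn) ((h1 n hn).sub h2) hq1).trans (add_le_add_left (h3 n hn) _)
  refine ⟨fun n hn => memLp_prod_of_section_le hq0 hq (hf n hn) hg hK
    (hle.mono fun z hz => hz n hn), memLp_prod_of_section_le hq0 hq hf₀ hg hK hle₀, ?_⟩
  refine tendsto_eLpNorm_prod hq0 hq (f := fun n x => f n x - f₀ x) (K := K + K) ?_ hg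
    (ENNReal.add_ne_top.2 ⟨hK, hK⟩) ?_ hlim
  · filter_upwards [hP] with n hn using (hf n hn).sub hf₀
  · filter_upwards [hP] with n hn
    filter_upwards [hm, hm₀, hle, hle₀] with z h1 h2 h3 h4
    rw [add_mul]
    exact (eLpNorm_sub_le (h1 n hn) h2 hq1).trans (add_le_add (h3 n hn) h4)

end ProductMeasure

/-! ### Integrability of the time singularity. -/

section Integrability

lemma lintegral_abs_rpow_lt_top {a : ℝ} (ha : -1 < a) (T : ℝ) :
    ∫⁻ x in Icc (-T) T, ENNReal.ofReal (|x| ^ a) < ∞ := by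
  have h1 : ∀ T : ℝ, IntervalIntegrable (fun x : ℝ => |x| ^ a) volume 0 T := by
    have hpos : ∀ T : ℝ, 0 ≤ T → IntervalIntegrable (fun x : ℝ => |x| ^ a) volume 0 T := by
      intro T hT
      refine (intervalIntegral.intervalIntegrable_rpow' ha (a := 0) (b := T)).congr ?_
      intro x hx
      rw [uIoc_of_le hT] at hx
      simp [abs_of_pos hx.1]
    intro T
    rcases le_total 0 T with hT | hT
    · exact hpos T hT
    · rw [IntervalIntegrable.iff_comp_neg]
      simpa using hpos (-T) (by linarith)
  have h2 : IntegrableOn (fun x : ℝ => |x| ^ a) (Icc (-T) T) := by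
    rcases le_total (-T) T with hT | hT
    · rw [integrableOn_Icc_iff_integrableOn_Ioc, ← intervalIntegrable_iff_integrableOn_Ioc_of_le hT]
      exact (h1 (-T)).symm.trans (h1 T)
    · rcases hT.eq_or_lt with h | h
      · rw [← h]; simp
      · rw [Icc_eq_empty (not_le.2 h)]; simp
  have h3 := h2.hasFiniteIntegral
  rw [hasFiniteIntegral_iff_ofReal (.of_forall fun x => by positivity)] at h3
  exact h3

lemma lintegral_abs_sub_rpow_le {a T c : ℝ} (hc : c ∈ Icc 0 T) :
    ∫⁻ x in Icc 0 T, ENNReal.ofReal (|x - c| ^ a)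
      ≤ ∫⁻ x in Icc (-T) T, ENNReal.ofReal (|x| ^ a) := by
  rw [← lintegral_indicator measurableSet_Icc, ← lintegral_indicator measurableSet_Icc,
    ← lintegral_sub_right_eq_self
      ((Icc (-T) T).indicator fun x => ENNReal.ofReal (|x| ^ a)) c]
  refine lintegral_mono fun x => ?_
  by_cases hx : x ∈ Icc 0 T
  · rw [indicator_of_mem hx, indicator_of_mem]
    exact ⟨by linarith [hx.1, hc.2], by linarith [hx.2, hc.1]⟩
  · rw [indicator_of_notMem hx]; exact zero_le

lemma memLp_of_lintegral_section_le {T q r : ℝ} (hq : 1 ≤ q) (hr : -1 < r * q)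
    {f : ℝ × ℝ → ℝ} (hf : Measurable f)
    (h : ∀ s ∈ Icc 0 T, ∃ c ∈ Icc 0 T, ∀ t, f (s, t) = |t - c|) :
    MemLp (fun z => f z ^ r) (ENNReal.ofReal q)
      ((volume.restrict (Icc 0 T)).prod (volume.restrict (Icc 0 T))) := by
  have hq0 : ENNReal.ofReal q ≠ 0 := by simp; linarith
  refine ⟨(hf.pow_const r).aestronglyMeasurable, ?_⟩
  rw [eLpNorm_lt_top_iff_lintegral_rpow_enorm_lt_top hq0 ENNReal.ofReal_ne_top,
    ENNReal.toReal_ofReal (by linarith), lintegral_prod _ (by fun_prop)]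
  have hle : ∀ s ∈ Icc (0 : ℝ) T, ∫⁻ t in Icc 0 T, ‖f (s, t) ^ r‖ₑ ^ q
      ≤ ∫⁻ x in Icc (-T) T, ENNReal.ofReal (|x| ^ (r * q)) := by
    intro s hs
    obtain ⟨c, hc, hf⟩ := h s hs
    refine le_trans (le_of_eq (lintegral_congr fun t => ?_)) (lintegral_abs_sub_rpow_le hc)
    rw [hf, Real.enorm_eq_ofReal (by positivity), ENNReal.ofReal_rpow_of_nonneg (by positivity)
      (by linarith), ← Real.rpow_mul (abs_nonneg _)]
  refine (setLIntegral_mono' measurableSet_Icc hle).trans_lt ?_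
  rw [setLIntegral_const]
  exact ENNReal.mul_lt_top (lintegral_abs_rpow_lt_top hr T) (by simp)

/-- For fixed `s`, the last two terms are powers of `|t - c|` with `c = 0` and `c = s`, integrable
uniformly in `c` after raising to the power `q`. The first term is the second with the times
swapped. -/
lemma memLp_singBound {H T q : ℝ} (hT : 0 < T) (hq : 1 ≤ q) (hr : -1 < (2 * H - 2) * q) :
    MemLp (singBound H) (ENNReal.ofReal q)
      ((volume : Measure (ℝ × ℝ)).restrict (Icc 0 T ×ˢ Icc 0 T)) := by
  rw [Measure.volume_eq_prod, ← Measure.prod_restrict]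
  have h0 : (0 : ℝ) ∈ Icc 0 T := ⟨le_rfl, hT.le⟩
  have h2 := memLp_of_lintegral_section_le (T := T) hq hr (f := fun z => |z.2|) (by fun_prop)
    fun s _ => ⟨0, h0, fun t => by simp⟩
  have h3 := memLp_of_lintegral_section_le (T := T) hq hr (f := fun z => |z.2 - z.1|)
    (by fun_prop) fun s hs => ⟨s, hs, fun t => rfl⟩
  have h1 := h2.comp_measurePreserving (Measure.measurePreserving_swap
    (μ := (volume : Measure ℝ).restrict (Icc 0 T)) (ν := (volume : Measure ℝ).restrict (Icc 0 T)))
  exact (h1.add h2).add h3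

end Integrability

/-! ### Measurability and pointwise convergence of the fields. -/

section Fields

lemma measurable_R (H : ℝ) : Measurable fun z : ℝ × ℝ => R H z.1 z.2 := by
  unfold R; fun_prop

lemma measurable_R_comp {α : Type*} [MeasurableSpace α] {f g : α → ℝ} (H : ℝ) (hf : Measurable f)
    (hg : Measurable g) : Measurable fun a => R H (f a) (g a) :=
  (measurable_R H).comp (hf.prodMk hg)

lemma measurable_inc {α : Type*} [MeasurableSpace α] {f g : α → ℝ} (H ε : ℝ) (hf : Measurable f)
    (hg : Measurable g) : Measurable fun a => inc H (f a) ε (g a) :=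
  (measurable_R_comp H (hf.add_const ε) hg).sub (measurable_R_comp H hf hg)

lemma measurable_Theta (H : ℝ) : Measurable fun z : ℝ × ℝ => Theta H z.1 z.2 := by
  simp_rw [Theta_eq, v]
  exact ((measurable_R_comp H measurable_fst measurable_fst).mul
    (measurable_R_comp H measurable_snd measurable_snd)).sub ((measurable_R H).pow_const 2)

lemma measurable_regL {p r : ℝ × ℝ → ℝ} (H : ℝ) (hp : Measurable p) (hr : Measurable r) :
    Measurable fun z : ℝ × ℝ => regL H z.1 z.2 (p z) (r z) :=
  ((hp.mul (measurable_R_comp H measurable_snd measurable_snd)).sub ((measurable_R H).mul hr)).div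
    (measurable_Theta H)

lemma measurable_regR {p r : ℝ × ℝ → ℝ} (H : ℝ) (hp : Measurable p) (hr : Measurable r) :
    Measurable fun z : ℝ × ℝ => regR H z.1 z.2 (p z) (r z) :=
  ((hr.mul (measurable_R_comp H measurable_fst measurable_fst)).sub ((measurable_R H).mul hp)).div
    (measurable_Theta H)

variable {d : ℕ}

lemma aestronglyMeasurable_regField {α : Type*} [MeasurableSpace α] {κ : Measure α}
    {z : α → ℝ × ℝ} (hz : Measurable z) {x y : α → Fin d → ℝ}
    (hx : AEStronglyMeasurable x κ) (hy : AEStronglyMeasurable y κ) (H : ℝ)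
    {p r p' r' k : ℝ × ℝ → ℝ} (hp : Measurable p) (hr : Measurable r) (hp' : Measurable p')
    (hr' : Measurable r') (hk : Measurable k) :
    AEStronglyMeasurable (fun a => regField H (z a).1 (z a).2 (p (z a)) (r (z a)) (p' (z a))
      (r' (z a)) (k (z a)) (x a) (y a)) κ := by
  have c : ∀ {f : ℝ × ℝ → ℝ}, Measurable f → AEStronglyMeasurable (fun a => f (z a)) κ :=
    fun hf => (hf.comp hz).aestronglyMeasurable
  have N : ∀ {ρ : ℝ × ℝ → ℝ} {x y : α → Fin d → ℝ}, Measurable ρ → AEStronglyMeasurable x κ →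
      AEStronglyMeasurable y κ →
      AEStronglyMeasurable (fun a => centred (ρ (z a)) (x a) (y a)) κ := by
    intro ρ x y hρ hx hy
    have hc : Continuous fun w : ℝ × (Fin d → ℝ) × (Fin d → ℝ) => centred w.1 w.2.1 w.2.2 := by
      unfold centred
      exact ((continuous_fst.comp continuous_snd).matrix_vecMulVec
        (continuous_snd.comp continuous_snd)).sub (continuous_fst.smul continuous_const)
    exact hc.comp_aestronglyMeasurable ((c hρ).prodMk (hx.prodMk hy))
  have a1 := measurable_regL H hp hr
  have a2 := measurable_regR H hp hr
  have b1 := measurable_regL H hp' hr'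
  have b2 := measurable_regR H hp' hr'
  exact (((((c (a1.mul b1)).smul (N (measurable_R_comp H measurable_fst measurable_fst) hx hx)).add
    ((c (a1.mul b2)).smul (N (measurable_R H) hx hy))).add
    ((c (a2.mul b1)).smul (N (measurable_R H) hy hx))).add
    ((c (a2.mul b2)).smul (N (measurable_R_comp H measurable_snd measurable_snd) hy hy))).add
    ((c hk).smul aestronglyMeasurable_const)

lemma tendsto_regField {ι : Type*} {l : Filter ι} {p r p' r' k : ι → ℝ}
    {p₀ r₀ p₀' r₀' k₀ : ℝ} (hp : Tendsto p l (𝓝 p₀)) (hr : Tendsto r l (𝓝 r₀))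
    (hp' : Tendsto p' l (𝓝 p₀')) (hr' : Tendsto r' l (𝓝 r₀')) (hk : Tendsto k l (𝓝 k₀))
    (H s t : ℝ) (x y : Fin d → ℝ) :
    Tendsto (fun n => regField H s t (p n) (r n) (p' n) (r' n) (k n) x y) l
      (𝓝 (regField H s t p₀ r₀ p₀' r₀' k₀ x y)) := by
  have hL : Tendsto (fun n => regL H s t (p n) (r n)) l (𝓝 (regL H s t p₀ r₀)) :=
    ((hp.mul_const _).sub (hr.const_mul _)).div_const _
  have hR : Tendsto (fun n => regR H s t (p n) (r n)) l (𝓝 (regR H s t p₀ r₀)) :=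
    ((hr.mul_const _).sub (hp.const_mul _)).div_const _
  have hL' : Tendsto (fun n => regL H s t (p' n) (r' n)) l (𝓝 (regL H s t p₀' r₀')) :=
    ((hp'.mul_const _).sub (hr'.const_mul _)).div_const _
  have hR' : Tendsto (fun n => regR H s t (p' n) (r' n)) l (𝓝 (regR H s t p₀' r₀')) :=
    ((hr'.mul_const _).sub (hp'.const_mul _)).div_const _
  exact (((((hL.mul hL').smul_const _).add ((hL.mul hR').smul_const _)).add
    ((hR.mul hL').smul_const _)).add ((hR.mul hR').smul_const _)).add (hk.smul_const _)

lemma tendsto_condField {H s t : ℝ} (hH : 1 / 2 < H) (hst : s ≠ t) (x y : Fin d → ℝ) :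
    Tendsto (fun e : ℝ × ℝ => condField H e.1 e.2 s t x y) (𝓝[>] 0 ×ˢ 𝓝[>] 0)
      (𝓝 (limField H s t x y)) :=
  tendsto_regField ((tendsto_inc_div hH s s).comp tendsto_fst)
    ((tendsto_inc_div hH s t).comp tendsto_fst) ((tendsto_inc_div hH t s).comp tendsto_snd)
    ((tendsto_inc_div hH t t).comp tendsto_snd) (tendsto_inc₂_div hH hst) H s t x y

lemma aestronglyMeasurable_condField {α : Type*} [MeasurableSpace α] {κ : Measure α}
    {z : α → ℝ × ℝ} (hz : Measurable z) {x y : α → Fin d → ℝ}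
    (hx : AEStronglyMeasurable x κ) (hy : AEStronglyMeasurable y κ) (H ε δ : ℝ) :
    AEStronglyMeasurable (fun a => condField H ε δ (z a).1 (z a).2 (x a) (y a)) κ := by
  have hi : ∀ {f g : ℝ × ℝ → ℝ} (e : ℝ), Measurable f → Measurable g →
      Measurable fun w => inc H (f w) e (g w) := fun e hf hg => measurable_inc H e hf hg
  have h1 := (hi ε measurable_fst measurable_fst).div_const ε
  have h2 := (hi ε measurable_fst measurable_snd).div_const ε
  have h3 := (hi δ measurable_snd measurable_fst).div_const δ
  have h4 := (hi δ measurable_snd measurable_snd).div_const δ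
  have h5 : Measurable fun w : ℝ × ℝ => inc₂ H w.1 ε w.2 δ / (ε * δ) :=
    ((hi δ measurable_snd (measurable_fst.add_const ε)).sub
      (hi δ measurable_snd measurable_fst)).div_const _
  have h := aestronglyMeasurable_regField hz hx hy H h1 h2 h3 h4 h5
  unfold condField
  with_reducible exact h

end Fields

/-! ### The explicit version of the conditional covariance field and its convergence. -/

section Convergence

variable {Ω : Type*} [MeasurableSpace Ω] {μ : Measure Ω} {d : ℕ} {H T : ℝ}
  {B : ℝ → Ω → (Fin d → ℝ)}

/-- Almost every pair of times consists of two distinct positive times. -/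
lemma ae_pos_ne (T : ℝ) : ∀ᵐ z : ℝ × ℝ ∂(volume.restrict (Icc 0 T ×ˢ Icc 0 T)),
    0 < z.1 ∧ 0 < z.2 ∧ z.1 ≠ z.2 := by
  have h1 : ∀ᵐ x : ℝ, x ≠ 0 := Measure.ae_ne volume 0
  have h2 : ∀ᵐ z : ℝ × ℝ, z.1 ≠ 0 := Measure.quasiMeasurePreserving_fst.ae h1
  have h3 : ∀ᵐ z : ℝ × ℝ, z.2 ≠ 0 := Measure.quasiMeasurePreserving_snd.ae h1
  have h4 : ∀ᵐ z : ℝ × ℝ, z.1 ≠ z.2 := by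
    rw [Measure.volume_eq_prod, Measure.ae_prod_iff_ae_ae]
    · exact .of_forall fun x => (Measure.ae_ne volume x).mono fun y hy => hy.symm
    · exact (measurableSet_eq_fun measurable_fst measurable_snd).compl
  filter_upwards [ae_restrict_mem (measurableSet_Icc.prod measurableSet_Icc),
    ae_restrict_of_ae h2, ae_restrict_of_ae h3, ae_restrict_of_ae h4] with z hz h2 h3 h4
  exact ⟨lt_of_le_of_ne hz.1.1 h2.symm, lt_of_le_of_ne hz.2.1 h3.symm, h4⟩

/-- `condField` evaluated along the process. -/
noncomputable def condProcess (H : ℝ) (B : ℝ → Ω → (Fin d → ℝ)) (e : ℝ × ℝ)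
    (x : Ω × (ℝ × ℝ)) : Matrix (Fin d) (Fin d) ℝ :=
  condField H e.1 e.2 x.2.1 x.2.2 (B x.2.1 x.1) (B x.2.2 x.1)

lemma aestronglyMeasurable_of_tendsto_generic {α E : Type*} [MeasurableSpace α] {κ : Measure α}
    [NormedAddCommGroup E] {ι : Type*} {l : Filter ι} [l.NeBot] [l.IsCountablyGenerated]
    {f : ι → α → E} {g : α → E} (hf : ∀ n, AEStronglyMeasurable (f n) κ)
    (h : ∀ᵐ a ∂κ, Tendsto (fun n => f n a) l (𝓝 (g a))) : AEStronglyMeasurable g κ :=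
  aestronglyMeasurable_of_tendsto_ae l hf h

namespace IsFBM

lemma aestronglyMeasurable_condProcess [SFinite μ]
    (hBmeas : AEStronglyMeasurable (fun p : Ω × ℝ => B p.2 p.1)
      (μ.prod (volume.restrict (Icc 0 T)))) (H : ℝ) (e : ℝ × ℝ) :
    AEStronglyMeasurable (condProcess H B e) (prodMeasure μ T) := by
  have hfst : AEStronglyMeasurable (fun x : Ω × (ℝ × ℝ) => B x.2.1 x.1) (prodMeasure μ T) := by
    rw [prodMeasure, Measure.volume_eq_prod, ← Measure.prod_restrict]
    exact hBmeas.comp_quasiMeasurePreserving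
      (MeasureTheory.QuasiMeasurePreserving.prodMap (.id μ) Measure.quasiMeasurePreserving_fst)
  have hsnd : AEStronglyMeasurable (fun x : Ω × (ℝ × ℝ) => B x.2.2 x.1) (prodMeasure μ T) := by
    rw [prodMeasure, Measure.volume_eq_prod, ← Measure.prod_restrict]
    exact hBmeas.comp_quasiMeasurePreserving
      (MeasureTheory.QuasiMeasurePreserving.prodMap (.id μ) Measure.quasiMeasurePreserving_snd)
  exact aestronglyMeasurable_condField measurable_snd hfst hsnd H e.1 e.2

lemma isCondCovField_condProcess (hB : IsFBM H B μ) (hH : 1 / 2 < H) (hH1 : H < 1)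
    (hBmeas : AEStronglyMeasurable (fun p : Ω × ℝ => B p.2 p.1)
      (μ.prod (volume.restrict (Icc 0 T)))) {ε δ : ℝ} (hε : 0 < ε) (hδ : 0 < δ) :
    IsCondCovField B μ T ε δ (condProcess H B (ε, δ)) := by
  have := hB.gaussian.isProbabilityMeasure
  refine ⟨aestronglyMeasurable_condProcess hBmeas H (ε, δ), ?_⟩
  filter_upwards [ae_pos_ne T] with z hz i j
  exact hB.condExp_eq_condField hH hH1 hz.1 hz.2.1 hz.2.2 hε hδ i j

lemma ae_eq_condProcess (hB : IsFBM H B μ) (hH : 1 / 2 < H) (hH1 : H < 1)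
    (hBmeas : AEStronglyMeasurable (fun p : Ω × ℝ => B p.2 p.1)
      (μ.prod (volume.restrict (Icc 0 T)))) {ε δ : ℝ} (hε : 0 < ε) (hδ : 0 < δ)
    {L : Ω × (ℝ × ℝ) → Matrix (Fin d) (Fin d) ℝ} (hL : IsCondCovField B μ T ε δ L) :
    condProcess H B (ε, δ) =ᵐ[prodMeasure μ T] L := by
  have := hB.gaussian.isProbabilityMeasure
  have hM := hB.isCondCovField_condProcess hH hH1 hBmeas hε hδ
  refine ae_eq_prod_of_sections hM.aestronglyMeasurable hL.aestronglyMeasurable ?_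
  filter_upwards [hM.version, hL.version] with z h1 h2
  have h3 : ∀ᵐ ω ∂μ, ∀ i j, condProcess H B (ε, δ) (ω, z) i j = L (ω, z) i j :=
    ae_all_iff.2 fun i => ae_all_iff.2 fun j => (h1 i j).trans (h2 i j).symm
  filter_upwards [h3] with ω hω
  ext i j
  exact hω i j

lemma eLpNorm_condField_le (hB : IsFBM H B μ) (hH : 1 / 2 < H) (hH1 : H < 1) {q : ℝ≥0∞}
    (hq : 1 ≤ q) {s t ε δ : ℝ} (hs : 0 < s) (ht : 0 < t) (hst : s ≠ t) (hε : 0 < ε)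
    (hδ : 0 < δ) :
    eLpNorm (fun ω => condField H ε δ s t (B s ω) (B t ω)) q μ ≤
      fieldConst d q * ENNReal.ofReal (16 / (1 - H)) * ‖singBound H (s, t)‖ₑ := by
  have h1H : 0 < 1 - H := by linarith
  have hc : 16 ≤ 16 / (1 - H) := by
    rw [le_div_iff₀ h1H]; linarith
  have hk : |inc₂ H s ε t δ / (ε * δ)| ≤ 16 / (1 - H) * singBound H (s, t) := by
    have h := abs_inc₂_le hH hH1 hst hε hδ
    have hp : 0 < ε * δ := mul_pos hε hδ
    rw [abs_div, abs_of_pos hp, div_le_iff₀ hp]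
    have h2 : 4 * |t - s| ^ (2 * H - 2) ≤ 16 / (1 - H) * singBound H (s, t) := by
      have h3 : |t - s| ^ (2 * H - 2) ≤ singBound H (s, t) := by
        unfold singBound
        have : 0 ≤ |s| ^ (2 * H - 2) := by positivity
        have : 0 ≤ |t| ^ (2 * H - 2) := by positivity
        simp only
        linarith
      have := singBound_nonneg H (s, t)
      nlinarith
    nlinarith
  rw [mul_assoc, Real.enorm_eq_ofReal (singBound_nonneg _ _), ← ENNReal.ofReal_mul (by positivity)]
  exact hB.eLpNorm_regField_le (by linarith) hq hs ht.le (Theta_pos hH hH1 hs ht hst).le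
    (regVar_inc_le hH hH1 hs ht hst hs.le hε) (regVar_inc_le hH hH1 hs ht hst ht.le hδ) hk

lemma tendsto_eLpNorm_condField (hB : IsFBM H B μ) (hH : 1 / 2 < H) {q : ℝ≥0∞} (hq : 1 ≤ q)
    (hq' : q ≠ ∞) {s t : ℝ} (hs : 0 ≤ s) (ht : 0 ≤ t) (hst : s ≠ t) :
    Tendsto (fun e : ℝ × ℝ => eLpNorm (fun ω => condField H e.1 e.2 s t (B s ω) (B t ω)
      - limField H s t (B s ω) (B t ω)) q μ) (𝓝[>] 0 ×ˢ 𝓝[>] 0) (𝓝 0) := by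
  have h := hB.tendsto_eLpNorm_regField hq hq' hs ht
      ((tendsto_inc_div hH s s).comp tendsto_fst) ((tendsto_inc_div hH s t).comp tendsto_fst)
      ((tendsto_inc_div hH t s).comp tendsto_snd) ((tendsto_inc_div hH t t).comp tendsto_snd)
      (tendsto_inc₂_div hH hst)
  simp only [Function.comp_def] at h
  unfold condField limField
  with_reducible exact h

lemma memLp_and_tendsto_condProcess (hB : IsFBM H B μ) (hH : 1 / 2 < H) (hH1 : H < 1)
    (hT : 0 < T) {q : ℝ} (hq : 1 ≤ q) (hq' : q < 1 / (2 - 2 * H))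
    (hBmeas : AEStronglyMeasurable (fun p : Ω × ℝ => B p.2 p.1)
      (μ.prod (volume.restrict (Icc 0 T)))) :
    (∀ e : ℝ × ℝ, 0 < e.1 ∧ 0 < e.2 →
      MemLp (condProcess H B e) (ENNReal.ofReal q) (prodMeasure μ T)) ∧
    MemLp (Lam H B μ) (ENNReal.ofReal q) (prodMeasure μ T) ∧
    Tendsto (fun e : ℝ × ℝ => eLpNorm (fun x => condProcess H B e x - Lam H B μ x)
      (ENNReal.ofReal q) (prodMeasure μ T)) (𝓝[>] (0 : ℝ) ×ˢ 𝓝[>] (0 : ℝ)) (𝓝 0) := by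
  have := hB.gaussian.isProbabilityMeasure
  have hq1 : 1 ≤ ENNReal.ofReal q := by simpa using ENNReal.ofReal_le_ofReal hq
  have hr : -1 < (2 * H - 2) * q := by
    rw [lt_div_iff₀ (by linarith)] at hq'
    nlinarith
  have hmeas := aestronglyMeasurable_condProcess (μ := μ) (T := T) (B := B) hBmeas H
  have hgood : ∀ᵐ x ∂(prodMeasure μ T), 0 < x.2.1 ∧ 0 < x.2.2 ∧ x.2.1 ≠ x.2.2 :=
    Measure.quasiMeasurePreserving_snd.ae (ae_pos_ne T)
  -- Joint measurability of the limit field is inherited from the approximations, which converge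
  -- pointwise at almost every point.
  have hLam : AEStronglyMeasurable (Lam H B μ) (prodMeasure μ T) := by
    refine aestronglyMeasurable_of_tendsto_generic (E := Matrix (Fin d) (Fin d) ℝ)
      (l := 𝓝[>] (0 : ℝ) ×ˢ 𝓝[>] (0 : ℝ)) hmeas ?_
    filter_upwards [hgood] with x hx
    have h := tendsto_condField hH hx.2.2 (B x.2.1 x.1) (B x.2.2 x.1)
    rw [← hB.Lam_eq hH hx.1.le hx.2.1.le] at h
    exact h
  have hsec : ∀ {s t : ℝ}, 0 < s → 0 < t →
      AEStronglyMeasurable (fun ω => B s ω) μ ∧ AEStronglyMeasurable (fun ω => B t ω) μ :=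
    fun hs ht => ⟨(hB.measurable _ hs.le).aestronglyMeasurable,
      (hB.measurable _ ht.le).aestronglyMeasurable⟩
  have hm : ∀ᵐ z : ℝ × ℝ ∂(volume.restrict (Icc 0 T ×ˢ Icc 0 T)), ∀ e : ℝ × ℝ,
      0 < e.1 ∧ 0 < e.2 → AEStronglyMeasurable (fun ω => condProcess H B e (ω, z)) μ := by
    filter_upwards [ae_pos_ne T] with z hz e _
    simp only [condProcess]
    exact aestronglyMeasurable_condField (z := fun _ => z) measurable_const (hsec hz.1 hz.2.1).1
      (hsec hz.1 hz.2.1).2 H e.1 e.2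
  have hm₀ : ∀ᵐ z : ℝ × ℝ ∂(volume.restrict (Icc 0 T ×ˢ Icc 0 T)),
      AEStronglyMeasurable (fun ω => Lam H B μ (ω, z)) μ := by
    filter_upwards [ae_pos_ne T] with z hz
    refine aestronglyMeasurable_of_tendsto_generic (E := Matrix (Fin d) (Fin d) ℝ)
      (l := 𝓝[>] (0 : ℝ) ×ˢ 𝓝[>] (0 : ℝ)) (fun e => aestronglyMeasurable_condField
        (z := fun _ => z) measurable_const (hsec hz.1 hz.2.1).1 (hsec hz.1 hz.2.1).2 H e.1 e.2)
      (.of_forall fun ω => ?_)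
    have h := tendsto_condField hH hz.2.2 (B z.1 ω) (B z.2 ω)
    rw [← hB.Lam_eq hH hz.1.le hz.2.1.le] at h
    exact h
  have hle : ∀ᵐ z : ℝ × ℝ ∂(volume.restrict (Icc 0 T ×ˢ Icc 0 T)), ∀ e : ℝ × ℝ,
      0 < e.1 ∧ 0 < e.2 → eLpNorm (fun ω => condProcess H B e (ω, z)) (ENNReal.ofReal q) μ ≤
        fieldConst d (ENNReal.ofReal q) * ENNReal.ofReal (16 / (1 - H)) * ‖singBound H z‖ₑ := by
    filter_upwards [ae_pos_ne T] with z hz e he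
    simp only [condProcess]
    exact hB.eLpNorm_condField_le hH hH1 hq1 hz.1 hz.2.1 hz.2.2 he.1 he.2
  have hlim : ∀ᵐ z : ℝ × ℝ ∂(volume.restrict (Icc 0 T ×ˢ Icc 0 T)),
      Tendsto (fun e : ℝ × ℝ => eLpNorm (fun ω => condProcess H B e (ω, z) - Lam H B μ (ω, z))
        (ENNReal.ofReal q) μ) (𝓝[>] 0 ×ˢ 𝓝[>] 0) (𝓝 0) := by
    filter_upwards [ae_pos_ne T] with z hz
    have e : ∀ ω, Lam H B μ (ω, z) = limField H z.1 z.2 (B z.1 ω) (B z.2 ω) :=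
      fun ω => hB.Lam_eq hH hz.1.le hz.2.1.le ω
    simp only [e, condProcess]
    with_reducible exact hB.tendsto_eLpNorm_condField hH hq1 ENNReal.ofReal_ne_top hz.1.le hz.2.1.le hz.2.2
  exact memLp_and_tendsto_of_sections (E := Matrix (Fin d) (Fin d) ℝ) hq1 ENNReal.ofReal_ne_top
    (l := 𝓝[>] (0 : ℝ) ×ˢ 𝓝[>] (0 : ℝ)) (P := fun e : ℝ × ℝ => 0 < e.1 ∧ 0 < e.2)
    (prod_mem_prod self_mem_nhdsWithin self_mem_nhdsWithin) (fun e _ => hmeas e) hLam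
    (memLp_singBound hT hq hr)
    (ENNReal.mul_ne_top (fieldConst_ne_top ENNReal.ofReal_ne_top) ENNReal.ofReal_ne_top)
    hm hm₀ hle hlim

end IsFBM

end Convergence

end FBM

theorem theorem1 {Ω : Type*} [MeasurableSpace Ω] (μ : Measure Ω) [IsProbabilityMeasure μ]
    (d : ℕ) (H T q : ℝ) (hH : 1 / 2 < H) (hH1 : H < 1) (hT : 0 < T)
    (hq : 1 ≤ q) (hq' : q < min (1 / (2 * H - 1)) (1 / (2 - 2 * H)))
    (B : ℝ → Ω → (Fin d → ℝ)) (hB : FBM.IsFBM H B μ)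
    (hBmeas : AEStronglyMeasurable (fun p : Ω × ℝ => B p.2 p.1)
      (μ.prod (volume.restrict (Icc 0 T)))) :
    -- the normalized conditional covariance field exists for all increments, lies in `L^q`,
    (∀ ε δ : ℝ, 0 < ε → 0 < δ →
      (∃ L, FBM.IsCondCovField B μ T ε δ L) ∧
      ∀ L, FBM.IsCondCovField B μ T ε δ L →
        MemLp L (ENNReal.ofReal q) (FBM.prodMeasure μ T)) ∧
    -- the limit field lies in `L^q`, and the convergence holds in `L^q`
    MemLp (FBM.Lam H B μ) (ENNReal.ofReal q) (FBM.prodMeasure μ T) ∧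
    ∀ L : ℝ → ℝ → Ω × (ℝ × ℝ) → Matrix (Fin d) (Fin d) ℝ,
      (∀ ε δ : ℝ, 0 < ε → 0 < δ → FBM.IsCondCovField B μ T ε δ (L ε δ)) →
      Tendsto (fun p : ℝ × ℝ => eLpNorm (fun x => L p.1 p.2 x - FBM.Lam H B μ x)
          (ENNReal.ofReal q) (FBM.prodMeasure μ T))
        (𝓝[>] (0 : ℝ) ×ˢ 𝓝[>] (0 : ℝ)) (𝓝 0) := by
  have hq2 : q < 1 / (2 - 2 * H) := hq'.trans_le (min_le_right _ _)
  obtain ⟨h1, h2, h3⟩ := hB.memLp_and_tendsto_condProcess hH hH1 hT hq hq2 hBmeas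
  refine ⟨fun ε δ hε hδ => ⟨⟨_, hB.isCondCovField_condProcess hH hH1 hBmeas hε hδ⟩,
    fun L hL => ?_⟩, h2, fun L hL => ?_⟩
  · exact (memLp_congr_ae (hB.ae_eq_condProcess hH hH1 hBmeas hε hδ hL)).1 (h1 (ε, δ) ⟨hε, hδ⟩)
  · refine h3.congr' ?_
    filter_upwards [prod_mem_prod self_mem_nhdsWithin self_mem_nhdsWithin] with e he
    refine eLpNorm_congr_ae ?_
    filter_upwards [hB.ae_eq_condProcess hH hH1 hBmeas he.1 he.2 (hL e.1 e.2 he.1 he.2)] with x hx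
    rw [← hx]
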